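/- Let $A\in\mathbb R^{n\times n}$ (possibly nonsymmetric) and let $Q\in\mathbb R^{n\times n}$ be symmetric positive semidefinite. For a real $n\times n$ matrix $M$ let $\mathrm{Off}(M)=\{M(s+1:n,1:s),\ M(1:s,s+1:n):\ s=1,\dots,n-1\}$ be the set of its maximal offdiagonal blocks; $M$ is quasiseparable of order $r$ if $r$ is the maximal rank of the matrices in $\mathrm{Off}(M)$. Suppose that $A$ and $Q$ are quasiseparable of orders $r_a$ and $r_q$, and that the numerical range $\mathcal W(A)=\{x^HAx:\ x\in\mathbb C^n,\ \|x\|_2=1\}$ is contained in the open left half plane $\{z\in\mathbb C:\ \Re(z)<0\}$. Let $X\in\mathbb R^{n\times n}$ be the symmetric positive semidefinite (stabilizing) solution of the Riccati equation $$A^\top X+XA-X^2+Q=0 .$$ Put $$t=4r_a+2r_q,\qquad \tau=\left|\min(\mathcal W(A)\cap\mathbb R)\right|,\qquad E=\mathcal W(A)+\left[-\tau-\sqrt{\tau^2+\|Q\|_2},\ 0\right],$$ and for sets $E,G\subset\mathbb C$ let $$Z_h(E,G)=\inf_{g\in\mathcal R_{h,h}}\frac{\sup_{z\in E}|g(z)|}{\inf_{z\in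 G}|g(z)|},$$ where $\mathcal R_{h,h}$ is the set of complex rational functions with numerator and denominator of degree at most $h$, restricted to those without poles in $E$ and without zeros in $G$. Then, for every $M\in\mathrm{Off}(X)$ and every $h=1,2,\dots$, the singular values $\sigma_1(M)\ge\sigma_2(M)\ge\cdots$ (with $\sigma_k(M)=0$ for $k$ larger than the size of $M$) satisfy $$\sigma_{ht+1}(M)\le(1+\sqrt2)^2\,Z_h(E,-E)\,\|X\|_2 ,$$ that is, $\sigma_{ht+1}(M)/\|X\|_2\le(1+\sqrt2)^2Z_h(E,-E)$ whenever $X\ne0$. -/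

import Mathlib

/- Set addition and negation are pointwise; the norm of a matrix is the spectral norm. -/
open scoped Pointwise Matrix.Norms.L2Operator

noncomputable section

/-- The numerical range `{xᴴ A x : x ∈ ℂⁿ, ‖x‖₂ = 1}` of a real square matrix `A`. -/
def numericalRange {n : ℕ} (A : Matrix (Fin n) (Fin n) ℝ) : Set ℂ :=
  {z | ∃ x : EuclideanSpace ℂ (Fin n), ‖x‖ = 1 ∧
    z = dotProduct (star (x : Fin n → ℂ)) ((A.map Complex.ofReal).mulVec (x : Fin n → ℂ))}

/-- The maximal strictly lower triangular block `M(s+1:n, 1:s)` (rows and columns are numbered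
from `0` here, so the rows are those with `s ≤ i` and the columns those with `j < s`). -/
def lowerOffBlock {n : ℕ} (M : Matrix (Fin n) (Fin n) ℝ) (s : ℕ) :
    Matrix {i : Fin n // s ≤ i.val} {j : Fin n // j.val < s} ℝ :=
  M.submatrix Subtype.val Subtype.val

/-- The maximal strictly upper triangular block `M(1:s, s+1:n)`. -/
def upperOffBlock {n : ℕ} (M : Matrix (Fin n) (Fin n) ℝ) (s : ℕ) :
    Matrix {i : Fin n // i.val < s} {j : Fin n // s ≤ j.val} ℝ :=
  M.submatrix Subtype.val Subtype.val

/-- The quasiseparable order: the maximal rank of the offdiagonal blocks with cut position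
`s = 1, …, n - 1` (it is `0` if `n ≤ 1`, when there are no such blocks). -/
def qsrank {n : ℕ} (M : Matrix (Fin n) (Fin n) ℝ) : ℕ :=
  (Finset.Ico 1 n).sup fun s => max (lowerOffBlock M s).rank (upperOffBlock M s).rank

/-- The `k`-th largest singular value `σ_k` of a real matrix, `k = 1, 2, …`, with multiplicity;
it is `0` if `k` exceeds the rank. -/
def singularValue {m n : Type*} [Fintype m] [Fintype n] [DecidableEq n]
    (M : Matrix m n ℝ) (k : ℕ) : ℝ :=
  (Matrix.toEuclideanLin M).singularValues (k - 1)

/-- `X` solves the continuous-time algebraic Riccati equation with coefficients `A, F, Q`. -/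
def SolvesRiccati {n : ℕ} (A F Q X : Matrix (Fin n) (Fin n) ℝ) : Prop :=
  A.transpose * X + X * A - X * F * X + Q = 0

/-- The modulus `|g(z)|` of a rational function, with value `∞` at a pole. (Numerator and
denominator are coprime, so the quotient is never `0 / 0`.) -/
def ratFuncModulus (g : RatFunc ℂ) (z : ℂ) : ENNReal :=
  ‖g.num.eval z‖ₑ / ‖g.denom.eval z‖ₑ

/-- Rational functions with numerator and denominator of degree at most `h`, without poles in `E`
and without zeros in `G`, i.e. those for which the Zolotarev quotient below is meaningful. -/
def zolotarevAdmissible (h : ℕ) (E G : Set ℂ) : Set (RatFunc ℂ) :=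
  {g | g.num.natDegree ≤ h ∧ g.denom.natDegree ≤ h ∧
    (∀ z ∈ E, g.denom.eval z ≠ 0) ∧ (∀ z ∈ G, g.num.eval z ≠ 0)}

/-- The Zolotarev number `Z_h(E, G)`: the optimal value of `sup_E |g| / inf_G |g|` over the
rational functions `g` with numerator and denominator of degree at most `h`. -/
def zolotarevNumber (h : ℕ) (E G : Set ℂ) : ENNReal :=
  ⨅ g ∈ zolotarevAdmissible h E G,
    (⨆ z ∈ E, ratFuncModulus g z) / (⨅ z ∈ G, ratFuncModulus g z)

/-- `τ = |min (W(A) ∩ ℝ)|`. If `n ≥ 1`, the set `W(A) ∩ ℝ` is compact and non-empty, so the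
infimum is a minimum. -/
def numericalRangeTau {n : ℕ} (A : Matrix (Fin n) (Fin n) ℝ) : ℝ :=
  |sInf {x : ℝ | (x : ℂ) ∈ numericalRange A}|

/-- The set `W(A) + [-τ - √(τ² + ‖Q‖₂), 0]`. -/
def decaySet {n : ℕ} (A Q : Matrix (Fin n) (Fin n) ℝ) : Set ℂ :=
  numericalRange A + (Complex.ofReal '' Set.Icc
    (-numericalRangeTau A - Real.sqrt (numericalRangeTau A ^ 2 + ‖Q‖)) 0)

end

/-!
For `0 ≤ X`, testing the Riccati equation with an eigenvector of the largest eigenvalue gives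
`‖X‖ ≤ √‖Q‖`, so `Aᵀ - X` and `A - X` have numerical ranges in `E`. Every offdiagonal block `Y` of
`X` solves a Sylvester equation `L Y - Y N = R` in which the numerical ranges of `L` and `N` lie in
`E` and `-E`, and `rank R ≤ 2 rₐ + r_q`.

If `g = p / q` has degree at most `d`, then `Y - g(L) Y g(N)⁻¹` has rank at most `d * rank R`, so
`‖g(L)‖ ‖g(N)⁻¹‖ ‖Y‖` bounds a singular value of `Y`. The norms are estimated by a variant of the
Crouzeix–Palencia argument. On a smooth convex curve around a convex set `K` that contains the
numerical range of `T`, the Cauchy kernel has nonnegative real part and integral `1`, whence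
`‖f(T) + φ(T)*‖ ≤ 2` for `|f| ≤ 1` and the Cauchy transform `φ` of the conjugate of `f`. With the
elementary bound `|φ| ≤ 3` this makes `K` a `3`-spectral set.

Since `h * (4 rₐ + 2 r_q) = 2 h * (2 rₐ + r_q)`, the function `g ^ 2` may be used in place of `g`:
the resulting bound `min 1 (9 Z²) ≤ 3 Z` is better than `(1 + √2)² Z`.
-/

noncomputable section

open MeasureTheory Metric
open Complex (I exp)
open scoped Real ComplexConjugate InnerProductSpace

/-! ### Trigonometrically convex functions -/

theorem deriv_deriv_nonneg_of_isLocalMin {f : ℝ → ℝ} {x : ℝ} (hf : ContinuousAt f x)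
    (hmin : IsLocalMin f x) : 0 ≤ deriv (deriv f) x := by
  by_contra! hneg
  have hmax : IsLocalMax f x := isLocalMax_of_deriv_deriv_neg hneg hmin.deriv_eq_zero hf
  have hconst : f =ᶠ[nhds x] fun _ => f x := by
    filter_upwards [hmin, hmax] with y hle hge using le_antisymm hge hle
  rw [hconst.deriv.deriv_eq] at hneg
  simp at hneg

theorem deriv_deriv_add_self_nonneg {k : ℝ → ℝ} (hk : ContDiff ℝ 2 k)
    (htrig : ∀ t u, 2 * Real.cos u * k t ≤ k (t + u) + k (t - u)) (t : ℝ) :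
    0 ≤ deriv (deriv k) t + k t := by
  have hk' : ∀ s, HasDerivAt k (deriv k s) s := fun s =>
    (hk.differentiable (by norm_num) s).hasDerivAt
  have hk'' : ∀ s, HasDerivAt (deriv k) (deriv (deriv k) s) s := fun s =>
    ((hk.deriv' (n := 1)).differentiable one_ne_zero s).hasDerivAt
  let F : ℝ → ℝ := fun u => k (t + u) + k (t - u) - 2 * Real.cos u * k t
  have hF : ∀ u, HasDerivAt F (deriv k (t + u) - deriv k (t - u) + 2 * Real.sin u * k t) u := by
    intro u
    refine ((((hk' (t + u)).comp_const_add t u).add ((hk' (t - u)).comp_const_sub t u)).sub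
      (((Real.hasDerivAt_cos u).const_mul 2).mul_const (k t))).congr_deriv ?_
    ring
  have hF' : HasDerivAt (deriv F) (deriv (deriv k) t + deriv (deriv k) t + 2 * k t) 0 := by
    rw [funext fun u => (hF u).deriv]
    refine ((((hk'' (t + 0)).comp_const_add t 0).sub ((hk'' (t - 0)).comp_const_sub t 0)).add
      (((Real.hasDerivAt_sin 0).const_mul 2).mul_const (k t))).congr_deriv ?_
    simp
  have hmin : IsLocalMin F 0 := Filter.Eventually.of_forall fun u => by
    have := htrig t u
    simp only [F, add_zero, sub_zero, Real.cos_zero]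
    linarith
  have := deriv_deriv_nonneg_of_isLocalMin (hF 0).continuousAt hmin
  rw [hF'.deriv] at this
  linarith

theorem exists_contDiff_of_uniformContinuous {h : ℝ → ℝ} (hh : UniformContinuous h) {T : ℝ}
    (hper : h.Periodic T) (htrig : ∀ t u, 2 * Real.cos u * h t ≤ h (t + u) + h (t - u))
    {ε : ℝ} (hε : 0 < ε) :
    ∃ k : ℝ → ℝ, ContDiff ℝ 2 k ∧ k.Periodic T ∧
      (∀ t u, 2 * Real.cos u * k t ≤ k (t + u) + k (t - u)) ∧ ∀ t, |k t - h t| ≤ ε := by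
  obtain ⟨δ, hδ, hclose⟩ := Metric.uniformContinuous_iff.1 hh ε hε
  let φ : ContDiffBump (0 : ℝ) := ⟨δ / 2, δ, half_pos hδ, half_lt_self hδ⟩
  have hexists : ∀ t, Integrable fun s => φ.normed volume s * h (t - s) := fun t =>
    φ.hasCompactSupport_normed.convolutionExists_left (ContinuousLinearMap.lsmul ℝ ℝ)
      φ.continuous_normed hh.continuous.locallyIntegrable t
  refine ⟨fun t => ∫ s, φ.normed volume s * h (t - s), ?_, fun t => ?_, fun t u => ?_,
    fun t => ?_⟩
  · exact φ.hasCompactSupport_normed.contDiff_convolution_left (ContinuousLinearMap.lsmul ℝ ℝ)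
      (n := 2) φ.contDiff_normed hh.continuous.locallyIntegrable
  · simp only [add_sub_right_comm t T, hper _]
  · rw [← integral_const_mul, ← integral_add (hexists _) (hexists _)]
    refine integral_mono ((hexists t).const_mul _) ((hexists _).add (hexists _)) fun s => ?_
    have := mul_le_mul_of_nonneg_left (htrig (t - s) u) (φ.nonneg_normed (μ := volume) s)
    simp only [add_sub_right_comm t u, sub_right_comm t u]
    linarith
  · exact φ.dist_normed_convolution_le (μ := volume) hh.continuous.aestronglyMeasurable
      fun s hs => (hclose hs).le

/-! ### Support functions of planar convex sets -/

/-- The component `Re (e^{-it} z)` of `z` in the direction `e^{it}`. -/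
def dirRe (t : ℝ) : ℂ →L[ℝ] ℝ := Real.cos t • Complex.reCLM + Real.sin t • Complex.imCLM

theorem dirRe_apply (t : ℝ) (z : ℂ) : dirRe t z = Real.cos t * z.re + Real.sin t * z.im := by
  simp [dirRe]

theorem dirRe_eq_re (t : ℝ) (z : ℂ) : dirRe t z = (exp (-(t * I)) * z).re := by
  rw [dirRe_apply, ← neg_mul, Complex.exp_mul_I]
  simp [← Complex.ofReal_cos, ← Complex.ofReal_sin, -Complex.ofReal_neg]

theorem dirRe_exp_mul (t : ℝ) (w : ℂ) : dirRe t (exp (t * I) * w) = w.re := by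
  rw [dirRe_eq_re, ← mul_assoc, ← Complex.exp_add, neg_add_cancel, Complex.exp_zero, one_mul]

theorem dirRe_le_norm (t : ℝ) (z : ℂ) : dirRe t z ≤ ‖z‖ := by
  rw [dirRe_eq_re]
  refine (Complex.re_le_norm _).trans_eq ?_
  rw [norm_mul, ← neg_mul, ← Complex.ofReal_neg, Complex.norm_exp_ofReal_mul_I, one_mul]

theorem dirRe_sub_dirRe_le (s t : ℝ) (z : ℂ) : dirRe t z - dirRe s z ≤ ‖z‖ * |t - s| := by
  have hfactor : exp (-(t * I)) - exp (-(s * I)) =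
      exp ((-s : ℝ) * I) * (exp (I * (s - t : ℝ)) - 1) := by
    rw [mul_sub, mul_one, ← Complex.exp_add]
    push_cast
    ring_nf
  calc dirRe t z - dirRe s z = ((exp (-(t * I)) - exp (-(s * I))) * z).re := by
        rw [dirRe_eq_re, dirRe_eq_re, sub_mul, Complex.sub_re]
    _ ≤ ‖exp (-(t * I)) - exp (-(s * I))‖ * ‖z‖ :=
        (Complex.re_le_norm _).trans_eq (norm_mul _ _)
    _ ≤ ‖z‖ * |t - s| := by
        rw [hfactor, norm_mul, Complex.norm_exp_ofReal_mul_I, one_mul, mul_comm, abs_sub_comm]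
        gcongr
        exact Real.norm_exp_I_mul_ofReal_sub_one_le

theorem norm_mul_dirRe_arg (v z : ℂ) : ‖v‖ * dirRe v.arg z = ⟪v, z⟫_ℝ := by
  rw [dirRe_apply, mul_add, ← mul_assoc, ← mul_assoc, Complex.norm_mul_cos_arg,
    Complex.norm_mul_sin_arg, Complex.inner, Complex.mul_re, Complex.conj_re, Complex.conj_im]
  ring

/-- `h` is the support function of `C`, as a function of the angle of the direction; the suprema
have to be attained, as they are for compact `C`. -/
structure IsSupportFun (C : Set ℂ) (h : ℝ → ℝ) : Prop where
  le : ∀ z ∈ C, ∀ t, dirRe t z ≤ h t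
  attained : ∀ t, ∃ a ∈ C, h t = dirRe t a

theorem exists_isSupportFun {C : Set ℂ} (hC : IsCompact C) (hne : C.Nonempty) :
    ∃ h, IsSupportFun C h := by
  have hmax : ∀ t, ∃ a ∈ C, ∀ z ∈ C, dirRe t z ≤ dirRe t a := fun t =>
    hC.exists_isMaxOn hne (dirRe t).continuous.continuousOn
  choose a ha hle using hmax
  exact ⟨fun t => dirRe t (a t), fun z hz t => hle t z hz, fun t => ⟨a t, ha t, rfl⟩⟩

namespace IsSupportFun

variable {C : Set ℂ} {h : ℝ → ℝ}

theorem periodic (H : IsSupportFun C h) : h.Periodic (2 * π) := by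
  intro t
  have hdir : ∀ z, dirRe (t + 2 * π) z = dirRe t z := by simp [dirRe_apply]
  obtain ⟨a, ha, hat⟩ := H.attained t
  obtain ⟨b, hb, hbt⟩ := H.attained (t + 2 * π)
  apply le_antisymm
  · rw [hbt, hdir]
    exact H.le b hb t
  · rw [hat, ← hdir]
    exact H.le a ha _

theorem uniformContinuous (H : IsSupportFun C h) (hC : Bornology.IsBounded C) :
    UniformContinuous h := by
  obtain ⟨R, hR⟩ := hC.exists_norm_le
  refine (LipschitzWith.of_le_add_mul' R fun t s => ?_).uniformContinuous
  obtain ⟨a, ha, hat⟩ := H.attained t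
  calc h t = dirRe s a + (dirRe t a - dirRe s a) := by rw [hat]; ring
    _ ≤ h s + ‖a‖ * |t - s| := add_le_add (H.le a ha s) (dirRe_sub_dirRe_le s t a)
    _ ≤ h s + R * dist t s := by
        rw [Real.dist_eq]
        gcongr
        exact hR a ha

theorem two_mul_cos_mul_le (H : IsSupportFun C h) (t u : ℝ) :
    2 * Real.cos u * h t ≤ h (t + u) + h (t - u) := by
  obtain ⟨a, ha, hat⟩ := H.attained t
  calc 2 * Real.cos u * h t = dirRe (t + u) a + dirRe (t - u) a := by
        simp only [hat, dirRe_apply, Real.cos_add, Real.sin_add, Real.cos_sub, Real.sin_sub]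
        ring
    _ ≤ h (t + u) + h (t - u) := add_le_add (H.le a ha _) (H.le a ha _)

theorem mem_thickening (H : IsSupportFun C h) (hC : IsCompact C) (hconv : Convex ℝ C) {w : ℂ}
    {δ : ℝ} (hδ : 0 < δ) (hw : ∀ φ, dirRe φ w < h φ + δ) : w ∈ thickening δ C := by
  obtain ⟨a, ha, -⟩ := H.attained 0
  obtain ⟨p, hp, hpmin⟩ := exists_norm_eq_iInf_of_complete_convex ⟨a, ha⟩ hC.isComplete hconv w
  have hobtuse := (norm_eq_iInf_iff_real_inner_le_zero hconv hp).1 hpmin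
  refine mem_thickening_iff.2 ⟨p, hp, ?_⟩
  rw [dist_eq_norm]
  rcases eq_or_ne w p with rfl | hwp
  · simpa using hδ
  have hpos : 0 < ‖w - p‖ := norm_pos_iff.2 (sub_ne_zero.2 hwp)
  let φ := (w - p).arg
  obtain ⟨b, hb, hbφ⟩ := H.attained φ
  have hb_le : dirRe φ b ≤ dirRe φ p := by
    have := hobtuse b hb
    rw [← norm_mul_dirRe_arg, map_sub] at this
    exact sub_nonpos.1 (nonpos_of_mul_nonpos_right this hpos)
  have hdist : dirRe φ (w - p) = ‖w - p‖ := by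
    have := norm_mul_dirRe_arg (w - p) (w - p)
    rw [real_inner_self_eq_norm_mul_norm] at this
    exact mul_left_cancel₀ hpos.ne' this
  have := hw φ
  rw [map_sub] at hdist
  linarith

end IsSupportFun

/-! ### Convex contours and their Cauchy kernel -/

theorem exp_periodic_mul_I : Function.Periodic (fun t : ℝ => exp (t * I)) (2 * π) := by
  intro t
  dsimp only
  rw [Complex.ofReal_add, add_mul]
  push_cast
  exact Complex.exp_periodic _

theorem hasDerivAt_exp_mul_I (t : ℝ) :
    HasDerivAt (fun t : ℝ => exp (t * I)) (exp (t * I) * I) t := by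
  simpa using ((Complex.ofRealCLM.hasDerivAt (x := t)).mul_const I).cexp

/-- The curve with support function `k`: its point with outer normal `e^{it}` is
`e^{it} (k(t) + i k'(t))`. -/
def supportCurve (k : ℝ → ℝ) (t : ℝ) : ℂ := exp (t * I) * (k t + I * deriv k t)

theorem dirRe_supportCurve (k : ℝ → ℝ) (t : ℝ) : dirRe t (supportCurve k t) = k t := by
  rw [supportCurve, dirRe_exp_mul]
  simp

theorem supportCurve_periodic {k : ℝ → ℝ} (hk : k.Periodic (2 * π)) :
    (supportCurve k).Periodic (2 * π) := by
  intro t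
  have hderiv : deriv k (t + 2 * π) = deriv k t := by
    rw [← deriv_comp_add_const, funext hk]
  have hexp : exp ((t + 2 * π : ℝ) * I) = exp (t * I) := exp_periodic_mul_I t
  rw [supportCurve, supportCurve, hk, hderiv, hexp]

theorem hasDerivAt_supportCurve {k : ℝ → ℝ} (hk : ContDiff ℝ 2 k) (t : ℝ) :
    HasDerivAt (supportCurve k) (I * exp (t * I) * (deriv (deriv k) t + k t : ℝ)) t := by
  have hk' : HasDerivAt k (deriv k t) t := (hk.differentiable (by norm_num) t).hasDerivAt
  have hk'' : HasDerivAt (deriv k) (deriv (deriv k) t) t :=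
    ((hk.deriv' (n := 1)).differentiable one_ne_zero t).hasDerivAt
  refine ((hasDerivAt_exp_mul_I t).mul
    (hk'.ofReal_comp.add (hk''.ofReal_comp.const_mul I))).congr_deriv ?_
  simp only [Pi.add_apply]
  push_cast
  linear_combination exp (t * I) * (deriv k t : ℝ) * Complex.I_sq

/-- A closed `C¹` curve `σ`, parametrized by the angle of its outer normal, that encloses the
`η`-neighbourhood of `C` and stays inside `U`; `ρ` is its radius of curvature. -/
structure IsConvexContour (C U : Set ℂ) (η : ℝ) (σ : ℝ → ℂ) (ρ : ℝ → ℝ) : Prop where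
  margin_pos : 0 < η
  continuous_density : Continuous ρ
  density_nonneg : ∀ t, 0 ≤ ρ t
  hasDerivAt : ∀ t : ℝ, HasDerivAt σ (I * exp (t * I) * ρ t) t
  periodic : σ.Periodic (2 * π)
  mem : ∀ t, σ t ∈ U
  dirRe_le : ∀ z ∈ C, ∀ t, dirRe t z + η ≤ dirRe t (σ t)

theorem dirRe_le_of_hasDerivAt {σ : ℝ → ℂ} {ρ : ℝ → ℝ} (hρ : ∀ t, 0 ≤ ρ t)
    (hσ : ∀ t : ℝ, HasDerivAt σ (I * exp (t * I) * ρ t) t)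
    (hper : σ.Periodic (2 * π)) (φ t : ℝ) : dirRe φ (σ t) ≤ dirRe φ (σ φ) := by
  let f : ℝ → ℝ := fun s => dirRe φ (σ s)
  have hf : ∀ s, HasDerivAt f (Real.sin (φ - s) * ρ s) s := by
    intro s
    refine ((dirRe φ).hasFDerivAt.comp_hasDerivAt s (hσ s)).congr_deriv ?_
    rw [dirRe_apply, Real.sin_sub]
    simp only [Complex.mul_re, Complex.mul_im, Complex.I_re, Complex.I_im, Complex.ofReal_re,
      Complex.ofReal_im, Complex.exp_ofReal_mul_I_re, Complex.exp_ofReal_mul_I_im]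
    ring
  have hcont : Continuous f := continuous_iff_continuousAt.2 fun s => (hf s).continuousAt
  obtain ⟨s, hs, hst⟩ := (hper.comp (dirRe φ)).exists_mem_Ico Real.two_pi_pos t (φ - π)
  refine (hst : f t = f s).trans_le ?_
  rcases le_total s φ with hle | hle
  · have hmono : MonotoneOn f (Set.Icc (φ - π) φ) := by
      refine monotoneOn_of_hasDerivWithinAt_nonneg (convex_Icc _ _) hcont.continuousOn
        (fun x _ => (hf x).hasDerivWithinAt) fun x hx => mul_nonneg ?_ (hρ x)
      rw [interior_Icc] at hx
      exact Real.sin_nonneg_of_nonneg_of_le_pi (by linarith [hx.2]) (by linarith [hx.1])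
    exact hmono ⟨hs.1, hle⟩ ⟨by linarith [Real.pi_pos], le_rfl⟩ hle
  · have hanti : AntitoneOn f (Set.Icc φ (φ + π)) := by
      refine antitoneOn_of_hasDerivWithinAt_nonpos (convex_Icc _ _) hcont.continuousOn
        (fun x _ => (hf x).hasDerivWithinAt) fun x hx =>
          mul_nonpos_of_nonpos_of_nonneg ?_ (hρ x)
      rw [interior_Icc] at hx
      exact Real.sin_nonpos_of_nonpos_of_neg_pi_le (by linarith [hx.1]) (by linarith [hx.2])
    exact hanti ⟨le_rfl, by linarith [Real.pi_pos]⟩ ⟨hle, by linarith [hs.2]⟩ hle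

theorem exists_isConvexContour {C : Set ℂ} (hC : IsCompact C) (hconv : Convex ℝ C)
    (hne : C.Nonempty) {δ : ℝ} (hδ : 0 < δ) :
    ∃ η σ ρ, IsConvexContour C (thickening δ C) η σ ρ := by
  obtain ⟨h, H⟩ := exists_isSupportFun hC hne
  obtain ⟨k, hk, hkper, hktrig, hkh⟩ := exists_contDiff_of_uniformContinuous
    (H.uniformContinuous hC.isBounded) H.periodic H.two_mul_cos_mul_le
    (show 0 < δ / 4 by positivity)
  let m : ℝ → ℝ := fun t => k t + δ / 2
  have hm : ContDiff ℝ 2 m := hk.add contDiff_const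
  have hmper : m.Periodic (2 * π) := fun t => congrArg (· + δ / 2) (hkper t)
  have hmtrig : ∀ t u, 2 * Real.cos u * m t ≤ m (t + u) + m (t - u) := fun t u => by
    have := mul_le_of_le_one_left hδ.le (Real.cos_le_one u)
    have := hktrig t u
    simp only [m]
    linarith
  have hσ := hasDerivAt_supportCurve hm
  have hρ := deriv_deriv_add_self_nonneg hm hmtrig
  have hσper := supportCurve_periodic hmper
  refine ⟨δ / 4, supportCurve m, _, by positivity, ?_, hρ, hσ, hσper, fun t => ?_,
    fun z hz t => ?_⟩
  · exact ((hm.deriv' (n := 1)).continuous_deriv le_rfl).add hm.continuous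
  · refine H.mem_thickening hC hconv hδ fun φ => ?_
    calc dirRe φ (supportCurve m t) ≤ dirRe φ (supportCurve m φ) :=
          dirRe_le_of_hasDerivAt hρ hσ hσper φ t
      _ = k φ + δ / 2 := dirRe_supportCurve m φ
      _ < h φ + δ := by linarith [(abs_le.1 (hkh φ)).2]
  · rw [dirRe_supportCurve]
    change _ ≤ k t + δ / 2
    linarith [H.le z hz t, (abs_le.1 (hkh t)).1]

/-- The Cauchy kernel `σ'(t) / (2πi (σ(t) - z))` of a contour with `σ'(t) = i e^{it} ρ(t)`. -/
def contourKernel (σ : ℝ → ℂ) (ρ : ℝ → ℝ) (t : ℝ) (z : ℂ) : ℂ :=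
  exp (t * I) * ρ t / (2 * π) / (σ t - z)

namespace IsConvexContour

variable {C U : Set ℂ} {η : ℝ} {σ : ℝ → ℂ} {ρ : ℝ → ℝ}

theorem continuous (K : IsConvexContour C U η σ ρ) : Continuous σ :=
  continuous_iff_continuousAt.2 fun s => (K.hasDerivAt s).continuousAt

theorem sub_dist_le_dirRe_sub (K : IsConvexContour C U η σ ρ) {p : ℂ} (hp : p ∈ C) (z : ℂ)
    (t : ℝ) : η - dist z p ≤ dirRe t (σ t - z) := by
  have hzp : dirRe t z - dirRe t p ≤ dist z p := by
    rw [← map_sub, dist_eq_norm]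
    exact dirRe_le_norm t (z - p)
  rw [map_sub]
  linarith [K.dirRe_le p hp t]

theorem dirRe_sub_pos (K : IsConvexContour C U η σ ρ) {z : ℂ} (hz : z ∈ thickening η C) (t : ℝ) :
    0 < dirRe t (σ t - z) := by
  obtain ⟨p, hp, hzp⟩ := mem_thickening_iff.1 hz
  exact (sub_pos.2 hzp).trans_le (K.sub_dist_le_dirRe_sub hp z t)

theorem sub_ne_zero (K : IsConvexContour C U η σ ρ) {z : ℂ} (hz : z ∈ thickening η C) (t : ℝ) :
    σ t - z ≠ 0 := fun h0 => by
  simpa [h0] using K.dirRe_sub_pos hz t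

theorem exists_ball_le_norm_sub (K : IsConvexContour C U η σ ρ) {z : ℂ}
    (hz : z ∈ thickening η C) :
    ∃ r > 0, ∀ w ∈ ball z r, w ∈ thickening η C ∧ ∀ t, r ≤ ‖σ t - w‖ := by
  obtain ⟨p, hp, hzp⟩ := mem_thickening_iff.1 hz
  refine ⟨(η - dist z p) / 2, by linarith, fun w hw => ?_⟩
  have hwp : dist w p ≤ dist w z + dist z p := dist_triangle w z p
  rw [mem_ball] at hw
  refine ⟨mem_thickening_iff.2 ⟨p, hp, by linarith⟩, fun t => ?_⟩
  linarith [K.sub_dist_le_dirRe_sub hp w t, dirRe_le_norm t (σ t - w)]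

theorem continuous_kernel (K : IsConvexContour C U η σ ρ) {z : ℂ} (hz : z ∈ thickening η C) :
    Continuous fun t => contourKernel σ ρ t z := by
  have hσ := K.continuous
  have hρ := K.continuous_density
  exact Continuous.div₀ (by fun_prop) (by fun_prop) (K.sub_ne_zero hz)

theorem kernel_re_nonneg (K : IsConvexContour C U η σ ρ) {z : ℂ} (hz : z ∈ thickening η C)
    (t : ℝ) : 0 ≤ (contourKernel σ ρ t z).re := by
  have hpos := K.dirRe_sub_pos hz t
  rw [dirRe_eq_re] at hpos
  have hρ := K.density_nonneg t
  have hkernel : contourKernel σ ρ t z =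
      (ρ t / (2 * π) : ℝ) * (exp (-(t * I)) * (σ t - z))⁻¹ := by
    rw [contourKernel, mul_inv, ← Complex.exp_neg, neg_neg]
    push_cast
    ring
  rw [hkernel, Complex.re_ofReal_mul, Complex.inv_re]
  have := Complex.normSq_nonneg (exp (-(t * I)) * (σ t - z))
  positivity

/-- `e^{-it} (σ(t) - z)` has positive real part, so its principal logarithm is differentiable. -/
theorem integral_kernel (K : IsConvexContour C U η σ ρ) {z : ℂ} (hz : z ∈ thickening η C) :
    ∫ t in (0 : ℝ)..2 * π, contourKernel σ ρ t z = 1 := by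
  have hπ : (π : ℂ) ≠ 0 := mod_cast Real.pi_ne_zero
  let L : ℝ → ℂ := fun t =>
    (Complex.log (exp (-(t * I)) * (σ t - z)) + t * I) / (2 * π * I)
  have hL : ∀ t, HasDerivAt L (contourKernel σ ρ t z) t := by
    intro t
    have hlin : HasDerivAt (fun t : ℝ => (t : ℂ) * I) (1 * I) t :=
      (Complex.ofRealCLM.hasDerivAt (x := t)).mul_const I
    have hpos : 0 < (exp (-(t * I)) * (σ t - z)).re := by
      rw [← dirRe_eq_re]
      exact K.dirRe_sub_pos hz t
    have hlog := (hlin.neg.cexp.mul ((K.hasDerivAt t).sub_const z)).clog_real (Or.inl hpos)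
    refine ((hlog.add hlin).div_const (2 * π * I)).congr_deriv ?_
    have hne := K.sub_ne_zero hz t
    have hexp : exp (-(t * I)) ≠ 0 := Complex.exp_ne_zero _
    simp only [Pi.mul_apply, Pi.neg_apply, contourKernel]
    field_simp
    ring
  rw [intervalIntegral.integral_eq_sub_of_hasDerivAt (fun t _ => hL t)
    ((K.continuous_kernel hz).intervalIntegrable _ _)]
  have hσ : σ (2 * π) = σ 0 := by simpa using K.periodic 0
  have hexp : exp (-((2 * π : ℝ) * I)) = 1 := by
    rw [Complex.exp_neg]
    push_cast
    rw [Complex.exp_two_pi_mul_I, inv_one]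
  simp only [L, hσ, hexp, Complex.ofReal_zero, zero_mul, neg_zero, Complex.exp_zero]
  push_cast
  field_simp
  ring

theorem integral_mul_deriv (K : IsConvexContour C U η σ ρ) (hU : IsOpen U) (hUc : Convex ℝ U)
    {f : ℂ → ℂ} (hf : DifferentiableOn ℂ f U) :
    ∫ t in (0 : ℝ)..2 * π, f (σ t) * (I * exp (t * I) * ρ t) = 0 := by
  obtain ⟨F, hF⟩ := hUc.exists_forall_hasDerivWithinAt hf
  have hcomp : ∀ t, HasDerivAt (fun t => F (σ t)) (f (σ t) * (I * exp (t * I) * ρ t)) t :=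
    fun t => ((hF _ (K.mem t)).hasDerivAt (hU.mem_nhds (K.mem t))).comp t (K.hasDerivAt t)
  have hfσ : Continuous fun t => f (σ t) := hf.continuousOn.comp_continuous K.continuous K.mem
  have hρ := K.continuous_density
  rw [intervalIntegral.integral_eq_sub_of_hasDerivAt (fun t _ => hcomp t)
    ((hfσ.mul (by fun_prop)).intervalIntegrable _ _)]
  simpa [sub_eq_zero] using congrArg F (K.periodic 0)

theorem integral_mul_kernel (K : IsConvexContour C U η σ ρ) (hU : IsOpen U) (hUc : Convex ℝ U)
    {f : ℂ → ℂ} (hf : DifferentiableOn ℂ f U) {z : ℂ} (hzU : z ∈ U) (hz : z ∈ thickening η C) :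
    ∫ t in (0 : ℝ)..2 * π, f (σ t) * contourKernel σ ρ t z = f z := by
  have hslope : DifferentiableOn ℂ (dslope f z) U :=
    (Complex.differentiableOn_dslope (hU.mem_nhds hzU)).2 hf
  have hslopeσ : Continuous fun t => dslope f z (σ t) :=
    hslope.continuousOn.comp_continuous K.continuous K.mem
  have hρ := K.continuous_density
  have hkernel := K.continuous_kernel hz
  have hπ : (π : ℂ) ≠ 0 := mod_cast Real.pi_ne_zero
  have hsplit : ∀ t, f (σ t) * contourKernel σ ρ t z = f z * contourKernel σ ρ t z +
      (2 * π * I)⁻¹ * (dslope f z (σ t) * (I * exp (t * I) * ρ t)) := by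
    intro t
    have hne := K.sub_ne_zero hz t
    rw [dslope_of_ne _ (_root_.sub_ne_zero.1 hne), slope_def_field, contourKernel]
    field_simp
    ring
  simp only [hsplit]
  rw [intervalIntegral.integral_add (Continuous.intervalIntegrable (by fun_prop) _ _)
      (Continuous.intervalIntegrable (by fun_prop) _ _),
    intervalIntegral.integral_const_mul, intervalIntegral.integral_const_mul,
    K.integral_mul_deriv hU hUc hslope, K.integral_kernel hz, mul_zero, add_zero, mul_one]

theorem hasDerivAt_kernel (K : IsConvexContour C U η σ ρ) {z : ℂ} (hz : z ∈ thickening η C)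
    (t : ℝ) : HasDerivAt (contourKernel σ ρ t)
      (exp (t * I) * ρ t / (2 * π) / (σ t - z) ^ 2) z := by
  refine (((hasDerivAt_id z).const_sub (σ t)).fun_inv (K.sub_ne_zero hz t)).const_mul
    (exp (t * I) * ρ t / (2 * π)) |>.congr_deriv ?_
  simp only [id_eq, neg_neg]
  ring

theorem differentiableOn_integral_mul_kernel (K : IsConvexContour C U η σ ρ) {F : ℝ → ℂ}
    (hF : Continuous F) : DifferentiableOn ℂ
      (fun z => ∫ t in (0 : ℝ)..2 * π, F t * contourKernel σ ρ t z) (thickening η C) := by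
  intro z hz
  obtain ⟨r, hr, hball⟩ := K.exists_ball_le_norm_sub hz
  have hσ := K.continuous
  have hρ := K.continuous_density
  let weight : ℝ → ℂ := fun t => exp (t * I) * ρ t / (2 * π)
  have hweight : Continuous weight := by fun_prop
  have hderiv_cont : Continuous fun t => F t * (weight t / (σ t - z) ^ 2) :=
    hF.mul (hweight.div₀ (by fun_prop) fun t => pow_ne_zero _ (K.sub_ne_zero hz t))
  refine (intervalIntegral.hasDerivAt_integral_of_dominated_loc_of_deriv_le
    (F' := fun w t => F t * (weight t / (σ t - w) ^ 2))
    (bound := fun t => ‖F t * weight t‖ / r ^ 2) (ball_mem_nhds z hr) ?_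
    ((hF.mul (K.continuous_kernel hz)).intervalIntegrable _ _)
    hderiv_cont.aestronglyMeasurable ?_
    (Continuous.intervalIntegrable (by fun_prop) _ _)
    ?_).2.differentiableAt.differentiableWithinAt
  · filter_upwards [ball_mem_nhds z hr] with w hw
    exact (hF.mul (K.continuous_kernel (hball w hw).1)).aestronglyMeasurable
  · refine Filter.Eventually.of_forall fun t _ w hw => ?_
    rw [← mul_div_assoc, norm_div, norm_pow]
    gcongr
    exact (hball w hw).2 t
  · exact Filter.Eventually.of_forall fun t _ w hw =>
      (K.hasDerivAt_kernel (hball w hw).1 t).const_mul (F t)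

theorem norm_integral_conj_mul_kernel_add_le (K : IsConvexContour C U η σ ρ) {F : ℝ → ℂ}
    (hF : Continuous F) (hF1 : ∀ t, ‖F t‖ ≤ 1) {z : ℂ} (hz : z ∈ thickening η C) :
    ‖(∫ t in (0 : ℝ)..2 * π, conj (F t) * contourKernel σ ρ t z) +
      conj (∫ t in (0 : ℝ)..2 * π, F t * contourKernel σ ρ t z)‖ ≤ 2 := by
  have hkernel := K.continuous_kernel hz
  have hre : ∫ t in (0 : ℝ)..2 * π, (contourKernel σ ρ t z).re = 1 := by
    have := Complex.reCLM.intervalIntegral_comp_comm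
      (hkernel.intervalIntegrable (μ := volume) 0 (2 * π))
    simpa [K.integral_kernel hz] using this
  have hsum : (∫ t in (0 : ℝ)..2 * π, conj (F t) * contourKernel σ ρ t z) +
      conj (∫ t in (0 : ℝ)..2 * π, F t * contourKernel σ ρ t z) =
      ∫ t in (0 : ℝ)..2 * π, conj (F t) * ((2 * (contourKernel σ ρ t z).re : ℝ) : ℂ) := by
    rw [← intervalIntegral.intervalIntegral_conj, ← intervalIntegral.integral_add
      (Continuous.intervalIntegrable (by fun_prop) _ _)
      (Continuous.intervalIntegrable (by fun_prop) _ _)]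
    simp only [map_mul, ← mul_add, Complex.add_conj]
  rw [hsum]
  calc _ ≤ ∫ t in (0 : ℝ)..2 * π, 2 * (contourKernel σ ρ t z).re := by
        refine intervalIntegral.norm_integral_le_of_norm_le Real.two_pi_pos.le
          (Filter.Eventually.of_forall fun t _ => ?_)
          (Continuous.intervalIntegrable (by fun_prop) _ _)
        have hnonneg := mul_nonneg zero_le_two (K.kernel_re_nonneg hz t)
        rw [norm_mul, RCLike.norm_conj, Complex.norm_real, Real.norm_of_nonneg hnonneg]
        exact mul_le_of_le_one_left hnonneg (hF1 t)
    _ = 2 := by rw [intervalIntegral.integral_const_mul, hre, mul_one]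

theorem norm_integral_conj_mul_kernel_le (K : IsConvexContour C U η σ ρ) (hU : IsOpen U)
    (hUc : Convex ℝ U) {f : ℂ → ℂ} (hf : DifferentiableOn ℂ f U) (hf1 : ∀ z ∈ U, ‖f z‖ ≤ 1)
    {z : ℂ} (hzU : z ∈ U) (hz : z ∈ thickening η C) :
    ‖∫ t in (0 : ℝ)..2 * π, conj (f (σ t)) * contourKernel σ ρ t z‖ ≤ 3 := by
  have hsum := K.norm_integral_conj_mul_kernel_add_le (F := fun t => f (σ t))
    (hf.continuousOn.comp_continuous K.continuous K.mem) (fun t => hf1 _ (K.mem t)) hz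
  rw [K.integral_mul_kernel hU hUc hf hzU hz] at hsum
  have hfz : ‖conj (f z)‖ ≤ 1 := (RCLike.norm_conj _).trans_le (hf1 z hzU)
  linarith [norm_le_add_norm_add (∫ t in (0 : ℝ)..2 * π, conj (f (σ t)) * contourKernel σ ρ t z)
    (conj (f z))]

end IsConvexContour

/-! ### Integrals of accretive operators -/

section Accretive

variable {H : Type*} [NormedAddCommGroup H] [InnerProductSpace ℂ H]

theorem two_mul_re_inner_apply_le {M : H →L[ℂ] H} (hM : M.IsPositive) (x y : H) :
    2 * (⟪M x, y⟫_ℂ).re ≤ M.reApplyInnerSelf x + M.reApplyInnerSelf y := by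
  have hsub := hM.2 (x - y)
  have hsymm : (⟪M y, x⟫_ℂ).re = (⟪M x, y⟫_ℂ).re := by
    rw [hM.inner_left_eq_inner_right, ← inner_conj_symm, Complex.conj_re]
  change 0 ≤ (⟪M (x - y), x - y⟫_ℂ).re at hsub
  change _ ≤ (⟪M x, x⟫_ℂ).re + (⟪M y, y⟫_ℂ).re
  simp only [map_sub, inner_sub_left, inner_sub_right, Complex.sub_re, hsymm] at hsub
  linarith

theorem re_inner_smul_apply_le {M : H →L[ℂ] H} (hM : M.IsPositive) {c : ℂ} (hc : ‖c‖ ≤ 1)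
    (x y : H) :
    (⟪(c • M) x, y⟫_ℂ).re ≤ M.reApplyInnerSelf x / 2 + M.reApplyInnerSelf y / 2 := by
  have hpolar := two_mul_re_inner_apply_le hM (c • x) y
  have hcx : ‖c‖ ^ 2 * M.reApplyInnerSelf x ≤ M.reApplyInnerSelf x :=
    mul_le_of_le_one_left (hM.2 x) (pow_le_one₀ (norm_nonneg c) hc)
  rw [M.reApplyInnerSelf_smul, map_smul] at hpolar
  rw [smul_apply]
  linarith

variable [CompleteSpace H]

theorem integral_re_inner_apply {M : ℝ → H →L[ℂ] H} (hM : Continuous M) (a b : ℝ) (x y : H) :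
    ∫ t in a..b, (⟪M t x, y⟫_ℂ).re = (⟪(∫ t in a..b, M t) x, y⟫_ℂ).re := by
  let evalRe : (H →L[ℂ] H) →L[ℝ] ℝ :=
    Complex.reCLM ∘L ((innerSL ℂ y ∘L ContinuousLinearMap.apply ℂ H x).restrictScalars ℝ)
  have heval : ∀ T : H →L[ℂ] H, evalRe T = (⟪T x, y⟫_ℂ).re := fun T => by
    rw [← inner_conj_symm, Complex.conj_re]
    rfl
  simpa only [heval] using
    evalRe.intervalIntegral_comp_comm (hM.intervalIntegrable (μ := volume) a b)

theorem norm_integral_smul_le {M : ℝ → H →L[ℂ] H} (hMc : Continuous M)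
    (hM : ∀ t, (M t).IsPositive) {a b : ℝ} (hab : a ≤ b) {f : ℝ → ℂ} (hf : Continuous f)
    (hf1 : ∀ t, ‖f t‖ ≤ 1) : ‖∫ t in a..b, f t • M t‖ ≤ ‖∫ t in a..b, M t‖ := by
  refine ContinuousLinearMap.opNorm_le_of_re_inner_le (norm_nonneg _) fun x y hx hy => ?_
  have hself : ∀ x, Continuous fun t => (M t).reApplyInnerSelf x := fun x =>
    Complex.continuous_re.comp ((hMc.clm_apply continuous_const).inner continuous_const)
  have hmass : ∀ x, ‖x‖ = 1 → ∫ t in a..b, (M t).reApplyInnerSelf x ≤ ‖∫ t in a..b, M t‖ := by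
    intro x hx
    calc ∫ t in a..b, (M t).reApplyInnerSelf x = (⟪(∫ t in a..b, M t) x, x⟫_ℂ).re :=
          integral_re_inner_apply hMc a b x x
      _ ≤ ‖(∫ t in a..b, M t) x‖ * ‖x‖ := re_inner_le_norm (𝕜 := ℂ) _ _
      _ ≤ ‖∫ t in a..b, M t‖ := by
          simpa only [hx, mul_one] using (∫ t in a..b, M t).le_opNorm x
  calc (⟪(∫ t in a..b, f t • M t) x, y⟫_ℂ).re
      = ∫ t in a..b, (⟪(f t • M t) x, y⟫_ℂ).re :=
        (integral_re_inner_apply (hf.smul hMc) a b x y).symm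
    _ ≤ ∫ t in a..b, ((M t).reApplyInnerSelf x / 2 + (M t).reApplyInnerSelf y / 2) := by
        refine intervalIntegral.integral_mono_on hab (Continuous.intervalIntegrable ?_ _ _)
          ((((hself x).div_const 2).add ((hself y).div_const 2)).intervalIntegrable _ _)
          fun t _ => re_inner_smul_apply_le (hM t) (hf1 t) x y
        exact Complex.continuous_re.comp
          (((hf.smul hMc).clm_apply continuous_const).inner continuous_const)
    _ = (∫ t in a..b, (M t).reApplyInnerSelf x) / 2 +
          (∫ t in a..b, (M t).reApplyInnerSelf y) / 2 := by
        rw [intervalIntegral.integral_add (((hself x).div_const 2).intervalIntegrable _ _)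
          (((hself y).div_const 2).intervalIntegrable _ _), intervalIntegral.integral_div,
          intervalIntegral.integral_div]
    _ ≤ ‖∫ t in a..b, M t‖ := by linarith [hmass x hx, hmass y hy]

theorem isPositive_add_star {N : H →L[ℂ] H} (hN : ∀ x, 0 ≤ N.reApplyInnerSelf x) :
    (N + star N).IsPositive := by
  refine ContinuousLinearMap.isPositive_def'.2 ⟨IsSelfAdjoint.add_star_self N, fun x => ?_⟩
  have hstar : (star N).reApplyInnerSelf x = N.reApplyInnerSelf x := by
    change (⟪star N x, x⟫_ℂ).re = (⟪N x, x⟫_ℂ).re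
    rw [ContinuousLinearMap.star_eq_adjoint, ContinuousLinearMap.adjoint_inner_left,
      ← inner_conj_symm, Complex.conj_re]
  have hadd : (N + star N).reApplyInnerSelf x = N.reApplyInnerSelf x + N.reApplyInnerSelf x := by
    nth_rw 2 [← hstar]
    simp only [ContinuousLinearMap.reApplyInnerSelf_apply, add_apply, inner_add_left, map_add]
  rw [hadd]
  linarith [hN x]

theorem norm_integral_smul_add_star_le_two {N : ℝ → H →L[ℂ] H} (hNc : Continuous N)
    (hN : ∀ t x, 0 ≤ (N t).reApplyInnerSelf x) {a b : ℝ} (hab : a ≤ b)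
    (hN1 : ∫ t in a..b, N t = 1) {f : ℝ → ℂ} (hf : Continuous f) (hf1 : ∀ t, ‖f t‖ ≤ 1) :
    ‖(∫ t in a..b, f t • N t) + star (∫ t in a..b, conj (f t) • N t)‖ ≤ 2 := by
  have hadd : ∀ {φ : ℝ → ℂ}, Continuous φ → ∫ t in a..b, φ t • (N t + star (N t)) =
      (∫ t in a..b, φ t • N t) + star (∫ t in a..b, conj (φ t) • N t) := by
    intro φ hφ
    have hstar : star (∫ t in a..b, conj (φ t) • N t) = ∫ t in a..b, φ t • star (N t) := by
      refine Eq.trans ((starL' ℝ (A := H →L[ℂ] H)).toContinuousLinearMap.intervalIntegral_comp_comm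
        (Continuous.intervalIntegrable (by fun_prop) _ _)).symm ?_
      refine intervalIntegral.integral_congr fun t _ => ?_
      change star (conj (φ t) • N t) = _
      rw [star_smul, ← starRingEnd_apply, Complex.conj_conj]
    rw [hstar, ← intervalIntegral.integral_add
      (Continuous.intervalIntegrable (by fun_prop) _ _)
      (Continuous.intervalIntegrable (by fun_prop) _ _)]
    simp only [smul_add]
  have hmass : ∫ t in a..b, (N t + star (N t)) = 1 + 1 := by
    simpa [hN1] using hadd (φ := fun _ => 1) continuous_const
  calc _ = ‖∫ t in a..b, f t • (N t + star (N t))‖ := by rw [hadd hf]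
    _ ≤ ‖∫ t in a..b, (N t + star (N t))‖ :=
        norm_integral_smul_le (by fun_prop) (fun t => isPositive_add_star (hN t)) hab hf hf1
    _ ≤ ‖(1 : H →L[ℂ] H)‖ + ‖(1 : H →L[ℂ] H)‖ := hmass ▸ norm_add_le _ _
    _ ≤ 1 + 1 := add_le_add ContinuousLinearMap.norm_id_le ContinuousLinearMap.norm_id_le
    _ = 2 := one_add_one_eq_two

end Accretive

/-! ### The numerical range is a 3-spectral set: diagonalizable operators -/

section InterpEval

open Polynomial

variable {F A : Type*} [Field F] [DecidableEq F] [Ring A] [Algebra F A]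

/-- The value `f(a)` at an element `a` annihilated by `∏ z ∈ s, (X - z)`, obtained by evaluating
the interpolation polynomial of `f` with nodes `s`. -/
def interpEval (s : Finset F) (a : A) (f : F → F) : A := aeval a (Lagrange.interpolate s id f)

theorem interpEval_eq_sum (s : Finset F) (a : A) (f : F → F) :
    interpEval s a f = ∑ z ∈ s, f z • aeval a (Lagrange.basis s id z) := by
  simp only [interpEval, Lagrange.interpolate_apply, map_sum, map_mul, aeval_C, Algebra.smul_def]

theorem interpEval_congr {s : Finset F} (a : A) {f g : F → F} (hfg : ∀ z ∈ s, f z = g z) :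
    interpEval s a f = interpEval s a g := by
  simp only [interpEval_eq_sum]
  exact Finset.sum_congr rfl fun z hz => by rw [hfg z hz]

variable {s : Finset F} {a : A}

theorem interpEval_smul (c : F) (f : F → F) :
    interpEval s a (fun z => c * f z) = c • interpEval s a f := by
  simp only [interpEval_eq_sum, Finset.smul_sum, smul_smul]

theorem aeval_eq_interpEval (ha : aeval a (Lagrange.nodal s id) = 0) {p : F[X]} {f : F → F}
    (hpf : ∀ z ∈ s, p.eval z = f z) : aeval a p = interpEval s a f := by
  have hdvd : Lagrange.nodal s id ∣ p - Lagrange.interpolate s id f := by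
    refine Finset.prod_dvd_of_coprime
      (fun x _ y _ hxy => isCoprime_X_sub_C_of_isUnit_sub (sub_ne_zero.2 hxy).isUnit)
      fun z hz => ?_
    have hnode : (Lagrange.interpolate s id f).eval z = f z :=
      Lagrange.eval_interpolate_at_node (v := id) f (Set.injOn_id _) hz
    rw [dvd_iff_isRoot, IsRoot, id_eq, eval_sub, hnode, hpf z hz, sub_self]
  obtain ⟨r, hr⟩ := hdvd
  rw [interpEval, ← sub_eq_zero, ← map_sub, hr, map_mul, ha, zero_mul]

theorem interpEval_mul (ha : aeval a (Lagrange.nodal s id) = 0) (f g : F → F) :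
    interpEval s a (fun z => f z * g z) = interpEval s a f * interpEval s a g := by
  refine .trans (aeval_eq_interpEval ha fun z hz => ?_).symm
    (map_mul (aeval a) (Lagrange.interpolate s id f) (Lagrange.interpolate s id g))
  have hnode := fun f => Lagrange.eval_interpolate_at_node (v := id) f (Set.injOn_id (s : Set F)) hz
  simp only [id_eq] at hnode
  rw [eval_mul, hnode, hnode]

theorem interpEval_one (ha : aeval a (Lagrange.nodal s id) = 0) :
    interpEval s a (fun _ => 1) = 1 := by
  rw [← map_one (aeval (R := F) a)]
  exact (aeval_eq_interpEval ha fun z _ => eval_one).symm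

theorem sub_mul_interpEval_inv (ha : aeval a (Lagrange.nodal s id) = 0) {w : F} (hw : w ∉ s) :
    (algebraMap F A w - a) * interpEval s a (fun z => (w - z)⁻¹) = 1 := by
  have hlin : algebraMap F A w - a = interpEval s a (fun z => w - z) := by
    rw [← aeval_eq_interpEval (p := C w - X) ha fun z _ => by simp, map_sub, aeval_C, aeval_X]
  have hinv : interpEval s a (fun z => (w - z) * (w - z)⁻¹) = interpEval s a fun _ => 1 :=
    interpEval_congr a fun z hz =>
      mul_inv_cancel₀ (sub_ne_zero.2 (ne_of_mem_of_not_mem hz hw).symm)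
  rw [hlin, ← interpEval_mul ha, hinv, interpEval_one ha]

end InterpEval

section

variable {A : Type*} [NormedRing A] [NormedAlgebra ℂ A] {s : Finset ℂ} {a : A}

theorem norm_interpEval_le {f : ℂ → ℂ} (hf : ∀ z ∈ s, ‖f z‖ ≤ 1) :
    ‖interpEval s a f‖ ≤ ∑ z ∈ s, ‖Polynomial.aeval a (Lagrange.basis s id z)‖ := by
  rw [interpEval_eq_sum]
  refine norm_sum_le_of_le s fun z hz => ?_
  rw [norm_smul]
  exact mul_le_of_le_one_left (norm_nonneg _) (hf z hz)

theorem continuous_interpEval {f : ℝ → ℂ → ℂ} (hf : ∀ z ∈ s, Continuous fun t => f t z) :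
    Continuous fun t => interpEval s a (f t) := by
  simp only [interpEval_eq_sum]
  exact continuous_finsetSum _ fun z hz => (hf z hz).smul continuous_const

theorem integral_interpEval [CompleteSpace A] {f : ℝ → ℂ → ℂ}
    (hf : ∀ z ∈ s, Continuous fun t => f t z) (b c : ℝ) :
    ∫ t in b..c, interpEval s a (f t) = interpEval s a fun z => ∫ t in b..c, f t z := by
  simp only [interpEval_eq_sum]
  have hint : ∀ z ∈ s, IntervalIntegrable
      (fun t => f t z • Polynomial.aeval a (Lagrange.basis s id z)) volume b c := fun z hz =>
    ((hf z hz).smul continuous_const).intervalIntegrable b c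
  rw [intervalIntegral.integral_finsetSum hint]
  simp only [intervalIntegral.integral_smul_const]

end

section NumRange

variable {H : Type*} [NormedAddCommGroup H] [InnerProductSpace ℂ H]

/-- The numerical range of a bounded operator. -/
def numRange (T : H →L[ℂ] H) : Set ℂ := (fun x => ⟪x, T x⟫_ℂ) '' sphere 0 1

theorem exists_mem_numRange_inner_eq (T : H →L[ℂ] H) {x : H} (hx : x ≠ 0) :
    ∃ w ∈ numRange T, ⟪x, T x⟫_ℂ = (‖x‖ ^ 2 : ℝ) * w := by
  refine ⟨_, ⟨((‖x‖⁻¹ : ℝ) : ℂ) • x, ?_, rfl⟩, ?_⟩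
  · simpa using norm_smul_inv_norm (𝕜 := ℂ) hx
  · have hne : (‖x‖ : ℂ) ≠ 0 := mod_cast norm_ne_zero_iff.2 hx
    simp only [map_smul, inner_smul_left, inner_smul_right, Complex.conj_ofReal]
    push_cast
    field_simp

theorem reApplyInnerSelf_exp_smul_nonneg {T R : H →L[ℂ] H} {w : ℂ}
    (hR : (algebraMap ℂ (H →L[ℂ] H) w - T) * R = 1) {t : ℝ}
    (hw : ∀ z ∈ numRange T, dirRe t z ≤ dirRe t w) (x : H) :
    0 ≤ (exp (t * I) • R).reApplyInnerSelf x := by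
  set u := R x
  have hx : x = w • u - T u := by
    simpa [Algebra.algebraMap_eq_smul_one] using congr($hR.symm x)
  have hre : (exp (t * I) • R).reApplyInnerSelf x = dirRe t ⟪u, x⟫_ℂ := by
    change (⟪exp (t * I) • u, x⟫_ℂ).re = _
    rw [inner_smul_left, ← Complex.exp_conj, dirRe_eq_re]
    simp
  rw [hre, hx, inner_sub_right, inner_smul_right, inner_self_eq_norm_sq_to_K]
  rcases eq_or_ne u 0 with h0 | h0
  · simp [h0]
  obtain ⟨z, hz, hzu⟩ := exists_mem_numRange_inner_eq T h0
  have hscale : w * (‖u‖ : ℂ) ^ 2 - (‖u‖ ^ 2 : ℝ) * z = (‖u‖ ^ 2) • (w - z) := by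
    rw [Complex.real_smul]
    push_cast
    ring
  rw [hzu]
  change 0 ≤ dirRe t (w * (‖u‖ : ℂ) ^ 2 - (‖u‖ ^ 2 : ℝ) * z)
  rw [hscale, map_smul, map_sub]
  exact mul_nonneg (by positivity) (sub_nonneg.2 (hw z hz))

end NumRange

/-- `f` is holomorphic and bounded by `1` on a neighbourhood of `C`. -/
def IsSchurNear (C : Set ℂ) (f : ℂ → ℂ) : Prop :=
  ∃ δ > 0, DifferentiableOn ℂ f (thickening δ C) ∧ ∀ z ∈ thickening δ C, ‖f z‖ ≤ 1

/-- If `‖a + b*‖ ≤ 2`, then `‖a‖⁴ = ‖a* a a* a‖ = ‖a* a (a + b*)* a - a* (a b a)‖`. -/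
theorem norm_pow_four_le {A : Type*} [CStarAlgebra A] {a b : A} (h : ‖a + star b‖ ≤ 2) :
    ‖a‖ ^ 4 ≤ 2 * ‖a‖ ^ 3 + ‖a‖ * ‖a * b * a‖ := by
  have hnorm : ‖star a * a * (star a * a)‖ = ‖a‖ ^ 4 := by
    have hsq : star a * a * (star a * a) = star (star a * a) * (star a * a) := by
      rw [star_mul, star_star]
    rw [hsq, CStarRing.norm_star_mul_self, CStarRing.norm_star_mul_self]
    ring
  have hsplit : star a * a * (star a * a) =
      star a * a * star (a + star b) * a - star a * (a * b * a) := by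
    rw [star_add, star_star]
    noncomm_ring
  calc ‖a‖ ^ 4 = ‖star a * a * star (a + star b) * a - star a * (a * b * a)‖ := by
        rw [← hnorm, hsplit]
    _ ≤ ‖star a * a * star (a + star b) * a‖ + ‖star a * (a * b * a)‖ := norm_sub_le _ _
    _ ≤ ‖a‖ * ‖a‖ * 2 * ‖a‖ + ‖a‖ * ‖a * b * a‖ := by
        gcongr
        · refine norm_mul_le_of_le (norm_mul_le_of_le (norm_mul_le_of_le ?_ le_rfl) ?_) le_rfl
          · rw [norm_star]
          · rwa [norm_star]
        · exact norm_mul_le_of_le (norm_star a).le le_rfl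
    _ = 2 * ‖a‖ ^ 3 + ‖a‖ * ‖a * b * a‖ := by ring

theorem le_three_of_pow_four_le {V : Set ℝ} (hV : BddAbove V)
    (hpow : ∀ x ∈ V, x ^ 4 ≤ 2 * x ^ 3 + x * (3 * sSup V)) : ∀ x ∈ V, x ≤ 3 := by
  intro y hy
  refine (le_csSup hV hy).trans ?_
  by_contra! hsup
  obtain ⟨x, hx, hlt⟩ := exists_lt_of_lt_csSup ⟨y, hy⟩
    (show (sSup V + 3) / 2 < sSup V by linarith)
  have hx3 : 3 < x := by linarith
  have hcube : x * (x ^ 3 - 2 * x ^ 2 - 3 * sSup V) ≤ 0 := by linarith [hpow x hx]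
  have hcube' : x ^ 3 - 2 * x ^ 2 - 3 * sSup V ≤ 0 :=
    nonpos_of_mul_nonpos_right hcube (by linarith)
  have hgrowth : 12 * (x - 3) ≤ x * (x + 1) * (x - 3) := by
    gcongr
    nlinarith
  linarith

section Crouzeix

variable {H : Type*} [NormedAddCommGroup H] [InnerProductSpace ℂ H] {T : H →L[ℂ] H}
  {s : Finset ℂ} {C U : Set ℂ} {η : ℝ} {σ : ℝ → ℂ} {ρ : ℝ → ℝ}

theorem reApplyInnerSelf_interpEval_kernel_nonneg (K : IsConvexContour C U η σ ρ)
    (hT : numRange T ⊆ C) (ha : Polynomial.aeval T (Lagrange.nodal s id) = 0) (hsC : ↑s ⊆ C)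
    (t : ℝ) (x : H) : 0 ≤ (interpEval s T (contourKernel σ ρ t)).reApplyInnerSelf x := by
  have hσ : σ t ∉ s := fun h => K.sub_ne_zero
    (self_subset_thickening K.margin_pos C (hsC h)) t (sub_self _)
  have hfactor : interpEval s T (contourKernel σ ρ t) = ((ρ t / (2 * π) : ℝ) : ℂ) •
      exp (t * I) • interpEval s T fun z => (σ t - z)⁻¹ := by
    rw [← interpEval_smul, ← interpEval_smul]
    congr 1 with z
    rw [contourKernel]
    push_cast
    ring
  have hres := reApplyInnerSelf_exp_smul_nonneg (sub_mul_interpEval_inv ha hσ) (t := t)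
    (fun z hz => by linarith [K.dirRe_le z (hT hz) t, K.margin_pos]) x
  have hρ := K.density_nonneg t
  rw [hfactor, ContinuousLinearMap.reApplyInnerSelf_apply, smul_apply, inner_smul_left,
    Complex.conj_ofReal]
  exact (mul_nonneg (by positivity) hres).trans_eq (Complex.re_ofReal_mul _ _).symm

variable [CompleteSpace H]

theorem norm_interpEval_add_star_le_two (K : IsConvexContour C U η σ ρ) (hU : IsOpen U)
    (hUc : Convex ℝ U) (hT : numRange T ⊆ C)
    (ha : Polynomial.aeval T (Lagrange.nodal s id) = 0) (hsC : ↑s ⊆ C) (hsU : ↑s ⊆ U)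
    {f : ℂ → ℂ} (hf : DifferentiableOn ℂ f U) (hf1 : ∀ z ∈ U, ‖f z‖ ≤ 1) :
    ‖interpEval s T f + star (interpEval s T fun z =>
      ∫ t in (0 : ℝ)..2 * π, conj (f (σ t)) * contourKernel σ ρ t z)‖ ≤ 2 := by
  have hmem : ∀ z ∈ s, z ∈ thickening η C := fun z hz =>
    self_subset_thickening K.margin_pos C (hsC hz)
  have hkernel : ∀ z ∈ s, Continuous fun t => contourKernel σ ρ t z := fun z hz =>
    K.continuous_kernel (hmem z hz)
  have hfσ : Continuous fun t => f (σ t) := hf.continuousOn.comp_continuous K.continuous K.mem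
  have hsmul : ∀ {φ : ℝ → ℂ}, Continuous φ →
      ∫ t in (0 : ℝ)..2 * π, φ t • interpEval s T (contourKernel σ ρ t) =
        interpEval s T fun z => ∫ t in (0 : ℝ)..2 * π, φ t * contourKernel σ ρ t z := by
    intro φ hφ
    simp only [← interpEval_smul]
    exact integral_interpEval (fun z hz => hφ.mul (hkernel z hz)) _ _
  have hmass : ∫ t in (0 : ℝ)..2 * π, interpEval s T (contourKernel σ ρ t) = 1 := by
    rw [integral_interpEval hkernel, ← interpEval_one ha]
    exact interpEval_congr T fun z hz => K.integral_kernel (hmem z hz)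
  have hcauchy : ∫ t in (0 : ℝ)..2 * π, f (σ t) • interpEval s T (contourKernel σ ρ t) =
      interpEval s T f := by
    rw [hsmul hfσ]
    exact interpEval_congr T fun z hz => K.integral_mul_kernel hU hUc hf (hsU hz) (hmem z hz)
  rw [← hcauchy, ← hsmul (φ := fun t => conj (f (σ t))) (Complex.continuous_conj.comp hfσ)]
  exact norm_integral_smul_add_star_le_two (continuous_interpEval hkernel)
    (reApplyInnerSelf_interpEval_kernel_nonneg K hT ha hsC) Real.two_pi_pos.le hmass hfσ
    fun t => hf1 _ (K.mem t)

theorem IsSchurNear.exists_norm_add_star_le_two {f : ℂ → ℂ} (hf : IsSchurNear C f)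
    (hC : IsCompact C) (hconv : Convex ℝ C) (hne : C.Nonempty) (hT : numRange T ⊆ C)
    (ha : Polynomial.aeval T (Lagrange.nodal s id) = 0) (hsC : ↑s ⊆ C) :
    ∃ g : ℂ → ℂ, ‖interpEval s T f + star (interpEval s T g)‖ ≤ 2 ∧
      IsSchurNear C fun z => 3⁻¹ * (f z * g z * f z) := by
  obtain ⟨δ, hδ, hfd, hf1⟩ := hf
  obtain ⟨η, σ, ρ, K⟩ := exists_isConvexContour hC hconv hne hδ
  have hUc := hconv.thickening δ
  have hfσ : Continuous fun t => f (σ t) := hfd.continuousOn.comp_continuous K.continuous K.mem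
  have hgd := K.differentiableOn_integral_mul_kernel (Complex.continuous_conj.comp hfσ)
  have hδsub : thickening (min δ η) C ⊆ thickening δ C := thickening_mono (min_le_left _ _) C
  have hηsub : thickening (min δ η) C ⊆ thickening η C := thickening_mono (min_le_right _ _) C
  refine ⟨_, norm_interpEval_add_star_le_two K isOpen_thickening hUc hT ha hsC
    (hsC.trans (self_subset_thickening hδ C)) hfd hf1, min δ η, lt_min hδ K.margin_pos,
    (((hfd.mono hδsub).mul (hgd.mono hηsub)).mul (hfd.mono hδsub)).const_mul _, fun z hz => ?_⟩
  have hg3 := K.norm_integral_conj_mul_kernel_le isOpen_thickening hUc hfd hf1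
    (hδsub hz) (hηsub hz)
  have hfz := hf1 z (hδsub hz)
  calc _ ≤ 3⁻¹ * (1 * 3 * 1 : ℝ) := by
        rw [norm_mul, norm_mul, norm_mul, norm_inv, Complex.norm_ofNat]
        gcongr
    _ = 1 := by norm_num

/-- The best constant `V` satisfies `V⁴ ≤ 2V³ + 3V²`, because `f g f / 3` competes in its
definition when `f` does; here `g` is the Cauchy transform of `conj f`. -/
theorem IsSchurNear.norm_interpEval_le_three {f : ℂ → ℂ} (hf : IsSchurNear C f)
    (hC : IsCompact C) (hconv : Convex ℝ C) (hne : C.Nonempty) (hT : numRange T ⊆ C)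
    (ha : Polynomial.aeval T (Lagrange.nodal s id) = 0) (hsC : ↑s ⊆ C) :
    ‖interpEval s T f‖ ≤ 3 := by
  have hbdd : BddAbove ((fun f => ‖interpEval s T f‖) '' {f | IsSchurNear C f}) := by
    refine ⟨_, Set.forall_mem_image.2 fun f hf => norm_interpEval_le fun z hz => ?_⟩
    obtain ⟨δ, hδ, -, hf1⟩ := hf
    exact hf1 z (self_subset_thickening hδ C (hsC hz))
  refine le_three_of_pow_four_le hbdd (Set.forall_mem_image.2 fun f hf => ?_) _ ⟨f, hf, rfl⟩
  obtain ⟨g, htwo, hg⟩ := IsSchurNear.exists_norm_add_star_le_two hf hC hconv hne hT ha hsC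
  have hsup := le_csSup hbdd ⟨_, hg, rfl⟩
  dsimp only at hsup
  rw [interpEval_smul, interpEval_mul ha, interpEval_mul ha, norm_smul, norm_inv,
    Complex.norm_ofNat, inv_mul_le_iff₀ three_pos] at hsup
  refine (norm_pow_four_le htwo).trans ?_
  gcongr

end Crouzeix

/-! ### The numerical range is a 3-spectral set: arbitrary matrices -/

section SimpleSpectrum

open Polynomial

theorem nodup_roots_iff_resultant_derivative_ne_zero {f : ℂ[X]} (hf : f ≠ 0) :
    f.roots.Nodup ↔ resultant f (derivative f) f.natDegree (f.natDegree - 1) ≠ 0 := by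
  rw [nodup_roots_iff_of_splits hf (IsAlgClosed.splits f), ← natDegree_derivative, Ne,
    resultant_eq_zero_iff, not_and, not_not]
  exact ⟨fun h _ => h, fun h => h (Or.inl hf)⟩

variable {ι : Type*} [Fintype ι] [DecidableEq ι]

theorem finite_not_nodup_roots_charpoly_add_smul {B D : Matrix ι ι ℂ}
    (hD : (B + D).charpoly.roots.Nodup) :
    {t : ℂ | ¬ (B + t • D).charpoly.roots.Nodup}.Finite := by
  set M : Matrix ι ι ℂ[X] := B.map C + (X : ℂ[X]) • D.map C with hM
  set r : ℂ[X] := resultant M.charpoly (derivative M.charpoly) (Fintype.card ι)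
    (Fintype.card ι - 1)
  have heval : ∀ t : ℂ, M.map (evalRingHom t) = B + t • D := by
    intro t
    ext i j
    simp [hM, mul_comm t]
  have hr : ∀ t : ℂ, (B + t • D).charpoly.roots.Nodup ↔ r.eval t ≠ 0 := by
    intro t
    rw [nodup_roots_iff_resultant_derivative_ne_zero (Matrix.charpoly_monic _).ne_zero,
      Matrix.charpoly_natDegree_eq_dim, ← heval, Matrix.charpoly_map, derivative_map,
      resultant_map_map, coe_evalRingHom]
  have hr0 : r ≠ 0 := fun h0 => (hr 1).1 (by rwa [one_smul]) (by rw [h0, eval_zero])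
  refine r.roots.toFinset.finite_toSet.subset fun t ht => ?_
  simpa [hr0] using not_not.1 (mt (hr t).2 ht)

theorem exists_nodup_roots_charpoly (ι : Type*) [Fintype ι] [DecidableEq ι] :
    ∃ D : Matrix ι ι ℂ, D.charpoly.roots.Nodup := by
  refine ⟨Matrix.diagonal fun i => ((Fintype.equivFin ι i : ℕ) : ℂ), ?_⟩
  rw [Matrix.charpoly_diagonal]
  refine nodup_roots (separable_prod_X_sub_C_iff.2 fun i j hij => ?_)
  exact (Fintype.equivFin ι).injective (Fin.ext (Nat.cast_injective (R := ℂ) hij))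

theorem dense_nodup_roots_charpoly : Dense {B : Matrix ι ι ℂ | B.charpoly.roots.Nodup} := by
  intro B
  obtain ⟨D, hD⟩ := exists_nodup_roots_charpoly ι
  have hline : Continuous fun t : ℂ => B + t • (D - B) := by fun_prop
  have hdense : (0 : ℂ) ∈ closure {t | (B + t • (D - B)).charpoly.roots.Nodup} := by
    have hfin := finite_not_nodup_roots_charpoly_add_smul (B := B) (D := D - B) (by simpa using hD)
    simpa only [Set.compl_ofPred, not_not] using hfin.countable.dense_compl ℂ 0
  simpa using map_mem_closure hline hdense fun t ht => ht

end SimpleSpectrum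

section SpectralSet

open Polynomial Filter Topology
open Matrix (toEuclideanCLM)

variable {ι : Type*} [Fintype ι] [DecidableEq ι]

theorem mem_numRange_of_isRoot_charpoly {B : Matrix ι ι ℂ} {z : ℂ} (hz : B.charpoly.IsRoot z) :
    z ∈ numRange (toEuclideanCLM (𝕜 := ℂ) B) := by
  rw [← Matrix.mem_spectrum_iff_isRoot_charpoly, ← Matrix.spectrum_toLpLin 2,
    ← Module.End.hasEigenvalue_iff_mem_spectrum] at hz
  obtain ⟨v, hv⟩ := hz.exists_hasEigenvector
  have hBv : toEuclideanCLM (𝕜 := ℂ) B v = z • v := hv.apply_eq_smul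
  obtain ⟨w, hw, hvw⟩ := exists_mem_numRange_inner_eq (toEuclideanCLM (𝕜 := ℂ) B) hv.2
  have hnorm : (‖v‖ : ℂ) ^ 2 ≠ 0 := pow_ne_zero 2 (mod_cast norm_ne_zero_iff.2 hv.2)
  rw [hBv, inner_smul_right, inner_self_eq_norm_sq_to_K, mul_comm] at hvw
  push_cast at hvw
  rwa [mul_left_cancel₀ hnorm hvw]

theorem aeval_toEuclideanCLM_charpoly (B : Matrix ι ι ℂ) :
    aeval (toEuclideanCLM (𝕜 := ℂ) B) B.charpoly = 0 := by
  rw [aeval_algHom_apply (toEuclideanCLM (𝕜 := ℂ) (n := ι)) B, Matrix.aeval_self_charpoly, map_zero]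

theorem norm_aeval_apply_le_of_nodup {B : Matrix ι ι ℂ} (hB : B.charpoly.roots.Nodup)
    {S : Set ℂ} (hS : IsCompact S) (hconv : Convex ℝ S) (hne : S.Nonempty)
    (hW : numRange (toEuclideanCLM (𝕜 := ℂ) B) ⊆ S) {δ : ℝ} (hδ : 0 < δ)
    {p q : ℂ[X]} {c : ℝ} (hc : 0 < c) (hq : ∀ z ∈ thickening δ S, q.eval z ≠ 0)
    (hpq : ∀ z ∈ thickening δ S, ‖p.eval z‖ ≤ c * ‖q.eval z‖) (y : EuclideanSpace ℂ ι) :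
    ‖aeval (toEuclideanCLM (𝕜 := ℂ) B) p y‖ ≤
      3 * c * ‖aeval (toEuclideanCLM (𝕜 := ℂ) B) q y‖ := by
  set T := toEuclideanCLM (𝕜 := ℂ) B
  set s : Finset ℂ := ⟨B.charpoly.roots, hB⟩
  have ha : aeval T (Lagrange.nodal s id) = 0 := by
    have hnodal : Lagrange.nodal s id = B.charpoly :=
      ((IsAlgClosed.splits _).eq_prod_roots_of_monic (Matrix.charpoly_monic B)).symm
    rw [hnodal, aeval_toEuclideanCLM_charpoly]
  have hsS : ↑s ⊆ S := fun z hz => hW (mem_numRange_of_isRoot_charpoly (isRoot_of_mem_roots hz))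
  have hsq : ∀ z ∈ s, q.eval z ≠ 0 := fun z hz => hq z (self_subset_thickening hδ S (hsS hz))
  have hcne : (c : ℂ) ≠ 0 := mod_cast hc.ne'
  have hschur : IsSchurNear S fun z => (c : ℂ)⁻¹ * (p.eval z / q.eval z) := by
    refine ⟨δ, hδ, (p.differentiable.differentiableOn.div
      q.differentiable.differentiableOn hq).const_mul _, fun z hz => ?_⟩
    rw [norm_mul, norm_div, norm_inv, Complex.norm_real, Real.norm_of_nonneg hc.le,
      inv_mul_le_iff₀ hc, mul_one, div_le_iff₀ (norm_pos_iff.2 (hq z hz))]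
    exact hpq z hz
  set F := interpEval s T fun z => (c : ℂ)⁻¹ * (p.eval z / q.eval z)
  have hfactor : aeval T p = (c : ℂ) • F * aeval T q := by
    rw [← interpEval_smul, aeval_eq_interpEval (p := q) ha fun _ _ => rfl, ← interpEval_mul ha]
    refine aeval_eq_interpEval ha fun z hz => ?_
    field_simp [hsq z hz]
  calc ‖aeval T p y‖ = ‖((c : ℂ) • F) (aeval T q y)‖ := by rw [hfactor]; rfl
    _ ≤ ‖(c : ℂ) • F‖ * ‖aeval T q y‖ := ContinuousLinearMap.le_opNorm _ _
    _ ≤ 3 * c * ‖aeval T q y‖ := by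
        rw [norm_smul, Complex.norm_real, Real.norm_of_nonneg hc.le, mul_comm 3]
        gcongr
        exact hschur.norm_interpEval_le_three hS hconv hne hW ha hsS

theorem numRange_subset_cthickening {H : Type*} [NormedAddCommGroup H] [InnerProductSpace ℂ H]
    {T T' : H →L[ℂ] H} {S : Set ℂ} (hT : numRange T ⊆ S) {δ : ℝ} (hTT' : ‖T' - T‖ ≤ δ) :
    numRange T' ⊆ cthickening δ S := by
  rintro _ ⟨x, hx, rfl⟩
  refine mem_cthickening_of_dist_le _ _ _ _ (hT ⟨x, hx, rfl⟩) ?_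
  rw [mem_sphere_zero_iff_norm] at hx
  calc dist ⟪x, T' x⟫_ℂ ⟪x, T x⟫_ℂ = ‖⟪x, (T' - T) x⟫_ℂ‖ := by
        rw [dist_eq_norm, ← inner_sub_right, sub_apply]
    _ ≤ ‖x‖ * ‖(T' - T) x‖ := norm_inner_le_norm _ _
    _ ≤ δ := by
        rw [hx, one_mul]
        exact ((T' - T).le_of_opNorm_le hTT' x).trans_eq (by rw [hx, mul_one])

theorem norm_aeval_apply_le_of_thickening {B : Matrix ι ι ℂ} {S : Set ℂ} (hS : IsCompact S)
    (hconv : Convex ℝ S) (hne : S.Nonempty) (hW : numRange (toEuclideanCLM (𝕜 := ℂ) B) ⊆ S)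
    {δ : ℝ} (hδ : 0 < δ) {p q : ℂ[X]} {c : ℝ} (hc : 0 < c)
    (hq : ∀ z ∈ thickening δ S, q.eval z ≠ 0)
    (hpq : ∀ z ∈ thickening δ S, ‖p.eval z‖ ≤ c * ‖q.eval z‖) (y : EuclideanSpace ℂ ι) :
    ‖aeval (toEuclideanCLM (𝕜 := ℂ) B) p y‖ ≤
      3 * c * ‖aeval (toEuclideanCLM (𝕜 := ℂ) B) q y‖ := by
  have hCLM : Continuous (toEuclideanCLM (𝕜 := ℂ) (n := ι)) :=
    LinearMap.continuous_of_finiteDimensional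
      (toEuclideanCLM (𝕜 := ℂ) (n := ι)).toAlgEquiv.toLinearMap
  have hlim : ∀ r : ℂ[X], Tendsto (fun B' => ‖aeval (toEuclideanCLM (𝕜 := ℂ) B') r y‖)
      (𝓝[{B | B.charpoly.roots.Nodup}] B) (𝓝 ‖aeval (toEuclideanCLM (𝕜 := ℂ) B) r y‖) := fun r =>
    (((Polynomial.continuous_aeval r).comp hCLM).clm_apply continuous_const).norm.tendsto B
      |>.mono_left nhdsWithin_le_nhds
  have hnear : ∀ᶠ B' in 𝓝[{B | B.charpoly.roots.Nodup}] B,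
      ‖toEuclideanCLM (𝕜 := ℂ) B' - toEuclideanCLM (𝕜 := ℂ) B‖ < δ / 2 := by
    refine eventually_nhdsWithin_of_eventually_nhds
      (((hCLM.sub continuous_const).norm.tendsto B).eventually_lt_const ?_)
    simpa using hδ
  have hthick : thickening (δ / 2) (cthickening (δ / 2) S) ⊆ thickening δ S := by
    simpa only [add_halves] using thickening_cthickening_subset (δ / 2) (half_pos hδ).le S
  have : (𝓝[{B | B.charpoly.roots.Nodup}] B).NeBot :=
    mem_closure_iff_nhdsWithin_neBot.1 (dense_nodup_roots_charpoly B)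
  refine le_of_tendsto_of_tendsto (hlim p) ((hlim q).const_mul (3 * c)) ?_
  filter_upwards [hnear, self_mem_nhdsWithin] with B' hB' hnodup
  exact norm_aeval_apply_le_of_nodup hnodup hS.cthickening (hconv.cthickening _)
    (hne.mono (self_subset_cthickening S)) (numRange_subset_cthickening hW hB'.le) (half_pos hδ)
    hc (fun z hz => hq z (hthick hz)) (fun z hz => hpq z (hthick hz)) y

theorem norm_aeval_apply_le {B : Matrix ι ι ℂ} {S : Set ℂ} (hS : IsCompact S)
    (hconv : Convex ℝ S) (hne : S.Nonempty) (hW : numRange (toEuclideanCLM (𝕜 := ℂ) B) ⊆ S)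
    {p q : ℂ[X]} {c : ℝ} (hc : 0 ≤ c) (hq : ∀ z ∈ S, q.eval z ≠ 0)
    (hpq : ∀ z ∈ S, ‖p.eval z‖ ≤ c * ‖q.eval z‖) (y : EuclideanSpace ℂ ι) :
    ‖aeval (toEuclideanCLM (𝕜 := ℂ) B) p y‖ ≤
      3 * c * ‖aeval (toEuclideanCLM (𝕜 := ℂ) B) q y‖ := by
  have hstrict : ∀ ε > 0, ‖aeval (toEuclideanCLM (𝕜 := ℂ) B) p y‖ ≤
      3 * (c + ε) * ‖aeval (toEuclideanCLM (𝕜 := ℂ) B) q y‖ := by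
    intro ε hε
    have hopen : IsOpen {z : ℂ | q.eval z ≠ 0 ∧ ‖p.eval z‖ < (c + ε) * ‖q.eval z‖} :=
      (isOpen_ne_fun q.continuous continuous_const).inter
        (isOpen_lt p.continuous.norm (continuous_const.mul q.continuous.norm))
    obtain ⟨δ, hδ, hsub⟩ := hS.exists_thickening_subset_open hopen fun z hz =>
      ⟨hq z hz, (hpq z hz).trans_lt
        (mul_lt_mul_of_pos_right (lt_add_of_pos_right c hε) (norm_pos_iff.2 (hq z hz)))⟩
    exact norm_aeval_apply_le_of_thickening hS hconv hne hW hδ (by positivity)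
      (fun z hz => (hsub hz).1) (fun z hz => (hsub hz).2.le) y
  have hlim : Tendsto (fun ε => 3 * (c + ε) * ‖aeval (toEuclideanCLM (𝕜 := ℂ) B) q y‖) (𝓝[>] 0)
      (𝓝 (3 * (c + 0) * ‖aeval (toEuclideanCLM (𝕜 := ℂ) B) q y‖)) :=
    (Continuous.tendsto (by fun_prop) 0).mono_left nhdsWithin_le_nhds
  rw [add_zero] at hlim
  exact ge_of_tendsto hlim (eventually_nhdsWithin_of_forall hstrict)

end SpectralSet

/-! ### Singular values of solutions of Sylvester equations -/

section RealImaginaryParts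

variable {ι κ : Type*} [Fintype κ]

/-- The entrywise real part of a complex vector. -/
def rePart (w : EuclideanSpace ℂ κ) : EuclideanSpace ℝ κ := WithLp.toLp 2 fun j => (w j).re

/-- The entrywise imaginary part of a complex vector. -/
def imPart (w : EuclideanSpace ℂ κ) : EuclideanSpace ℝ κ := WithLp.toLp 2 fun j => (w j).im

theorem norm_sq_eq_rePart_add_imPart (w : EuclideanSpace ℂ κ) :
    ‖w‖ ^ 2 = ‖rePart w‖ ^ 2 + ‖imPart w‖ ^ 2 := by
  simp only [EuclideanSpace.norm_sq_eq, ← Finset.sum_add_distrib, rePart, imPart]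
  refine Finset.sum_congr rfl fun i _ => ?_
  rw [Complex.sq_norm, Complex.normSq_apply, Real.norm_eq_abs, Real.norm_eq_abs, sq_abs, sq_abs]
  ring

variable [DecidableEq κ]

theorem rePart_toEuclideanLin_map (M : Matrix ι κ ℝ) (w : EuclideanSpace ℂ κ) :
    rePart (Matrix.toEuclideanLin (M.map Complex.ofReal) w) =
      Matrix.toEuclideanLin M (rePart w) := by
  ext i
  simp [rePart, Matrix.toLpLin_apply, Matrix.mulVec, dotProduct]

theorem imPart_toEuclideanLin_map (M : Matrix ι κ ℝ) (w : EuclideanSpace ℂ κ) :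
    imPart (Matrix.toEuclideanLin (M.map Complex.ofReal) w) =
      Matrix.toEuclideanLin M (imPart w) := by
  ext i
  simp [imPart, Matrix.toLpLin_apply, Matrix.mulVec, dotProduct]

variable [Fintype ι]

theorem norm_sq_toEuclideanLin_map (M : Matrix ι κ ℝ) (w : EuclideanSpace ℂ κ) :
    ‖Matrix.toEuclideanLin (M.map Complex.ofReal) w‖ ^ 2 =
      ‖Matrix.toEuclideanLin M (rePart w)‖ ^ 2 + ‖Matrix.toEuclideanLin M (imPart w)‖ ^ 2 := by
  rw [norm_sq_eq_rePart_add_imPart, rePart_toEuclideanLin_map, imPart_toEuclideanLin_map]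

theorem norm_toEuclideanLin_map_le (M : Matrix ι κ ℝ) (w : EuclideanSpace ℂ κ) :
    ‖Matrix.toEuclideanLin (M.map Complex.ofReal) w‖ ≤ ‖M‖ * ‖w‖ := by
  have hreal (x : EuclideanSpace ℝ κ) : ‖Matrix.toEuclideanLin M x‖ ^ 2 ≤ ‖M‖ ^ 2 * ‖x‖ ^ 2 := by
    rw [← mul_pow]
    exact pow_le_pow_left₀ (norm_nonneg _) (Matrix.l2_opNorm_mulVec M x) 2
  refine le_of_sq_le_sq ?_ (by positivity)
  rw [norm_sq_toEuclideanLin_map, mul_pow, norm_sq_eq_rePart_add_imPart w, mul_add]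
  exact add_le_add (hreal _) (hreal _)

end RealImaginaryParts

section SingularValues

/-- The `u i` are eigenvectors of `T†T` for its `r + 1` largest eigenvalues. -/
theorem exists_orthonormal_sq_singularValues_mul_le {E F : Type*} [NormedAddCommGroup E]
    [InnerProductSpace ℝ E] [FiniteDimensional ℝ E] [NormedAddCommGroup F] [InnerProductSpace ℝ F]
    [FiniteDimensional ℝ F] (T : E →ₗ[ℝ] F) {r : ℕ} (hr : r < Module.finrank ℝ E) :
    ∃ u : Fin (r + 1) → E, Orthonormal ℝ u ∧ ∀ a : Fin (r + 1) → ℝ,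
      T.singularValues r ^ 2 * ‖∑ i, a i • u i‖ ^ 2 ≤ ‖T (∑ i, a i • u i)‖ ^ 2 := by
  set hsymm := T.isSymmetric_adjoint_comp_self
  set b := hsymm.eigenvectorBasis rfl
  set e : Fin (r + 1) → Fin (Module.finrank ℝ E) := Fin.castLE hr
  have hon : Orthonormal ℝ (b ∘ e) := b.orthonormal.comp e (Fin.castLE_injective hr)
  refine ⟨b ∘ e, hon, fun a => ?_⟩
  have heigen : T.adjoint (T (∑ i, a i • (b ∘ e) i)) =
      ∑ i, (hsymm.eigenvalues rfl (e i) * a i) • (b ∘ e) i := by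
    rw [← LinearMap.comp_apply, map_sum]
    refine Finset.sum_congr rfl fun i _ => ?_
    rw [map_smul, Function.comp_apply, hsymm.apply_eigenvectorBasis, smul_smul, mul_comm]
    rfl
  rw [← real_inner_self_eq_norm_sq (T _), ← LinearMap.adjoint_inner_right, heigen, hon.inner_sum,
    ← real_inner_self_eq_norm_sq, hon.inner_sum, Finset.mul_sum]
  refine Finset.sum_le_sum fun i _ => ?_
  have hle : T.singularValues r ^ 2 ≤ hsymm.eigenvalues rfl (e i) := by
    rw [T.sq_singularValues_of_lt rfl hr]
    exact hsymm.eigenvalues_antitone rfl (Nat.le_of_lt_succ i.is_lt)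
  rw [mul_left_comm, conj_trivial]
  nlinarith [mul_self_nonneg (a i)]

variable {ι κ : Type*} [Fintype κ] [DecidableEq κ] [Fintype ι]

theorem exists_linearMap_singularValues_mul_norm_le (M : Matrix ι κ ℝ) {r : ℕ}
    (hr : r < Module.finrank ℝ (EuclideanSpace ℝ κ)) :
    ∃ Φ : (Fin (r + 1) → ℂ) →ₗ[ℂ] EuclideanSpace ℂ κ, Function.Injective Φ ∧ ∀ a,
      (Matrix.toEuclideanLin M).singularValues r * ‖Φ a‖ ≤
        ‖Matrix.toEuclideanLin (M.map Complex.ofReal) (Φ a)‖ := by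
  obtain ⟨u, hon, hu⟩ := exists_orthonormal_sq_singularValues_mul_le (Matrix.toEuclideanLin M) hr
  set Φ : (Fin (r + 1) → ℂ) →ₗ[ℂ] EuclideanSpace ℂ κ := Fintype.linearCombination ℂ
    fun i => WithLp.toLp 2 fun j => ((u i j : ℝ) : ℂ) with hΦ
  have hre : ∀ a, rePart (Φ a) = ∑ i, (a i).re • u i := by
    intro a
    ext j
    simp [rePart, hΦ, Fintype.linearCombination_apply]
  have him : ∀ a, imPart (Φ a) = ∑ i, (a i).im • u i := by
    intro a
    ext j
    simp [imPart, hΦ, Fintype.linearCombination_apply]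
  refine ⟨Φ, (injective_iff_map_eq_zero Φ).2 fun a ha => funext fun i => ?_, fun a => ?_⟩
  · have hindep := Fintype.linearIndependent_iff.1 hon.linearIndependent
    refine Complex.ext (hindep (fun i => (a i).re) ?_ i) (hindep (fun i => (a i).im) ?_ i)
    · rw [← hre, ha]
      rfl
    · rw [← him, ha]
      rfl
  · refine le_of_sq_le_sq ?_ (norm_nonneg _)
    rw [mul_pow, norm_sq_eq_rePart_add_imPart (Φ a), norm_sq_toEuclideanLin_map, mul_add, hre, him]
    exact add_le_add (hu _) (hu _)

theorem singularValue_le_of_norm_le_on_ker {V : Type*} [AddCommGroup V] [Module ℂ V]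
    [FiniteDimensional ℂ V] {M : Matrix ι κ ℝ} {r : ℕ} {c : ℝ} (hc : 0 ≤ c)
    (g : EuclideanSpace ℂ κ →ₗ[ℂ] V) (hV : Module.finrank ℂ V ≤ r)
    (hM : ∀ w, g w = 0 → ‖Matrix.toEuclideanLin (M.map Complex.ofReal) w‖ ≤ c * ‖w‖) :
    singularValue M (r + 1) ≤ c := by
  rw [singularValue, Nat.add_sub_cancel]
  rcases le_or_gt (Module.finrank ℝ (EuclideanSpace ℝ κ)) r with hr | hr
  · rwa [LinearMap.singularValues_of_finrank_le _ hr]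
  obtain ⟨Φ, hΦ, hlow⟩ := exists_linearMap_singularValues_mul_norm_le M hr
  have hker : (g ∘ₗ Φ).ker ≠ ⊥ := by
    apply LinearMap.ker_ne_bot_of_finrank_lt
    rw [Module.finrank_fin_fun]
    lia
  obtain ⟨a, ha, ha0⟩ := Submodule.exists_mem_ne_zero_of_ne_bot hker
  have hpos : 0 < ‖Φ a‖ := norm_pos_iff.2 ((map_ne_zero_iff Φ hΦ).2 ha0)
  exact le_of_mul_le_mul_right ((hlow a).trans (hM (Φ a) ha)) hpos

end SingularValues

section Sylvester

open Polynomial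
open Matrix (toEuclideanCLM toEuclideanLin)

theorem exists_eq_mul_rank {ι κ K : Type*} [Finite ι] [Fintype κ] [Field K] (M : Matrix ι κ K) :
    ∃ (F : Matrix ι (Fin M.rank) K) (G : Matrix (Fin M.rank) κ K), M = F * G := by
  classical
  set b := Module.finBasis K (LinearMap.range M.mulVecLin)
  set col : κ → LinearMap.range M.mulVecLin := fun c => ⟨M.mulVecLin (Pi.single c 1), _, rfl⟩
  refine ⟨Matrix.of fun i j => (b j : ι → K) i, Matrix.of fun j c => b.repr (col c) j, ?_⟩
  ext i c
  have hcol : (col c : ι → K) i = M i c := by simp [col]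
  have hsum := congr(($(b.sum_repr (col c)) : ι → K) i)
  simp only [AddSubmonoidClass.coe_finsetSum, Finset.sum_apply, Submodule.coe_smul,
    Pi.smul_apply, smul_eq_mul, hcol] at hsum
  simp only [← hsum, Matrix.mul_apply, Matrix.of_apply, mul_comm]
  rfl

theorem apply_aeval_eq_of_intertwine {𝕜 V W : Type*} [NontriviallyNormedField 𝕜]
    [NormedAddCommGroup V] [NormedSpace 𝕜 V] [NormedAddCommGroup W] [NormedSpace 𝕜 W]
    {L : W →L[𝕜] W} {N : V →L[𝕜] V} {M : V →ₗ[𝕜] W} {d : ℕ} {v : V}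
    (h : ∀ j < d, L (M ((N ^ j) v)) = M (N ((N ^ j) v))) {p : 𝕜[X]} (hp : p.natDegree ≤ d) :
    M (aeval N p v) = aeval L p (M v) := by
  have hpow : ∀ j ≤ d, M ((N ^ j) v) = (L ^ j) (M v) := by
    intro j
    induction j with
    | zero => simp
    | succ j ih =>
      intro hj
      rw [pow_succ', pow_succ', mul_apply_eq_comp, mul_apply_eq_comp,
        ← ih (by lia), h j hj]
  simp only [aeval_eq_sum_range, sum_apply, map_sum, smul_apply, map_smul]
  exact Finset.sum_congr rfl fun j hj => by rw [hpow j (by grind)]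

variable {ι κ : Type*} [Fintype ι] [DecidableEq ι] [Fintype κ] [DecidableEq κ]

theorem injective_aeval_of_eval_ne_zero {B : Matrix κ κ ℂ} {S : Set ℂ} (hS : IsCompact S)
    (hconv : Convex ℝ S) (hne : S.Nonempty) (hW : numRange (toEuclideanCLM (𝕜 := ℂ) B) ⊆ S)
    {p : ℂ[X]} (hp : ∀ z ∈ S, p.eval z ≠ 0) :
    Function.Injective (aeval (toEuclideanCLM (𝕜 := ℂ) B) p) := by
  obtain ⟨c, hc⟩ := hS.exists_bound_of_continuousOn (f := fun z => (p.eval z)⁻¹)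
    (p.continuous.continuousOn.inv₀ hp)
  have hc0 : 0 ≤ c := (norm_nonneg _).trans (hc _ hne.some_mem)
  have hone : ∀ z ∈ S, ‖(1 : ℂ[X]).eval z‖ ≤ c * ‖p.eval z‖ := by
    intro z hz
    rw [eval_one, norm_one, ← inv_le_iff_one_le_mul₀ (norm_pos_iff.2 (hp z hz)), ← norm_inv]
    exact hc z hz
  refine (injective_iff_map_eq_zero _).2 fun y hy => ?_
  simpa [hy] using norm_aeval_apply_le hS hconv hne hW hc0 hp hone y

theorem toEuclideanCLM_apply_eq_of_sylvester {τ : Type*} [Fintype τ]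
    {L : Matrix ι ι ℝ} {N : Matrix κ κ ℝ} {M : Matrix ι κ ℝ} {F : Matrix ι τ ℝ} {G : Matrix τ κ ℝ}
    (h : L * M - M * N = F * G) {x : EuclideanSpace ℂ κ}
    (hx : toEuclideanLin (G.map Complex.ofReal) x = 0) :
    toEuclideanCLM (𝕜 := ℂ) (L.map Complex.ofReal) (toEuclideanLin (M.map Complex.ofReal) x) =
      toEuclideanLin (M.map Complex.ofReal)
        (toEuclideanCLM (𝕜 := ℂ) (N.map Complex.ofReal) x) := by
  have hcomplex : L.map Complex.ofRealHom * M.map Complex.ofRealHom -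
      M.map Complex.ofRealHom * N.map Complex.ofRealHom =
      F.map Complex.ofRealHom * G.map Complex.ofRealHom := by
    simpa only [Matrix.map_sub _ (map_sub _), Matrix.map_mul] using
      congr(($h).map Complex.ofRealHom)
  have hGx : (G.map Complex.ofRealHom).mulVec x = 0 := congr(WithLp.ofLp $hx)
  have hvec := congr(($hcomplex).mulVec x)
  simp only [Matrix.sub_mulVec, ← Matrix.mulVec_mulVec, hGx, Matrix.mulVec_zero,
    sub_eq_zero] at hvec
  exact congr(WithLp.toLp 2 $hvec)

/-- On `ker (G · N ^ j · p(N)⁻¹, j < d)`, where `L M - M N = F G`, one has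
`M p(N) = p(L) M` and `M q(N) = q(L) M`, hence `M = p(L) q(L)⁻¹ M q(N) p(N)⁻¹`. -/
theorem singularValue_le_of_sylvester {L : Matrix ι ι ℝ} {N : Matrix κ κ ℝ} (M : Matrix ι κ ℝ)
    {S₁ S₂ : Set ℂ} (hS₁ : IsCompact S₁) (hS₁c : Convex ℝ S₁) (hS₁n : S₁.Nonempty)
    (hS₂ : IsCompact S₂) (hS₂c : Convex ℝ S₂) (hS₂n : S₂.Nonempty)
    (hL : numRange (toEuclideanCLM (𝕜 := ℂ) (L.map Complex.ofReal)) ⊆ S₁)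
    (hN : numRange (toEuclideanCLM (𝕜 := ℂ) (N.map Complex.ofReal)) ⊆ S₂)
    {p q : ℂ[X]} {d : ℕ} (hp : p.natDegree ≤ d) (hq : q.natDegree ≤ d)
    (hq0 : ∀ z ∈ S₁, q.eval z ≠ 0) (hp0 : ∀ z ∈ S₂, p.eval z ≠ 0) {c : ℝ} (hc : 0 ≤ c)
    (hpq : ∀ z ∈ S₁, ‖p.eval z‖ ≤ c * ‖q.eval z‖) (hqp : ∀ z ∈ S₂, ‖q.eval z‖ ≤ ‖p.eval z‖) :
    singularValue M (d * (L * M - M * N).rank + 1) ≤ 9 * c * ‖M‖ := by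
  obtain ⟨F, G, hFG⟩ := exists_eq_mul_rank (L * M - M * N)
  set Lc := toEuclideanCLM (𝕜 := ℂ) (L.map Complex.ofReal)
  set Nc := toEuclideanCLM (𝕜 := ℂ) (N.map Complex.ofReal)
  set Mc := toEuclideanLin (M.map Complex.ofReal)
  set Gc := toEuclideanLin (G.map Complex.ofReal)
  set e := LinearEquiv.ofInjectiveEndo (aeval Nc p).toLinearMap
    (injective_aeval_of_eval_ne_zero hS₂ hS₂c hS₂n hN hp0)
  set g : EuclideanSpace ℂ κ →ₗ[ℂ] Fin d → EuclideanSpace ℂ (Fin (L * M - M * N).rank) :=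
    LinearMap.pi fun j => Gc ∘ₗ (Nc ^ (j : ℕ)).toLinearMap ∘ₗ e.symm.toLinearMap
  refine singularValue_le_of_norm_le_on_ker (by positivity) g ?_ fun w hw => ?_
  · rw [Module.finrank_pi_fintype]
    simp
  set v := e.symm w
  have hw' : aeval Nc p v = w := e.apply_symm_apply w
  have hcomm : ∀ {r : ℂ[X]}, r.natDegree ≤ d → Mc (aeval Nc r v) = aeval Lc r (Mc v) := fun hr =>
    apply_aeval_eq_of_intertwine
      (fun j hj => toEuclideanCLM_apply_eq_of_sylvester hFG (congrFun hw ⟨j, hj⟩)) hr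
  calc ‖Mc w‖ = ‖aeval Lc p (Mc v)‖ := by rw [← hcomm hp, hw']
    _ ≤ 3 * c * ‖aeval Lc q (Mc v)‖ := norm_aeval_apply_le hS₁ hS₁c hS₁n hL hc hq0 hpq _
    _ = 3 * c * ‖Mc (aeval Nc q v)‖ := by rw [hcomm hq]
    _ ≤ 3 * c * (‖M‖ * (3 * 1 * ‖aeval Nc p v‖)) := by
        gcongr
        refine (norm_toEuclideanLin_map_le M _).trans ?_
        gcongr
        exact norm_aeval_apply_le hS₂ hS₂c hS₂n hN zero_le_one hp0 (by simpa only [one_mul]) v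
    _ = 9 * c * ‖M‖ * ‖w‖ := by
        rw [hw']
        ring

end Sylvester

/-! ### Geometry of the numerical range -/

section ToeplitzHausdorff

variable {H : Type*} [NormedAddCommGroup H] [InnerProductSpace ℂ H]

theorem exists_norm_eq_one_im_conj_mul_add_mul_eq_zero (a b : ℂ) :
    ∃ c : ℂ, ‖c‖ = 1 ∧ (conj c * a + c * b).im = 0 := by
  refine ⟨exp (-(b - conj a).arg * I), mod_cast Complex.norm_exp_ofReal_mul_I _, ?_⟩
  set c := exp (-(b - conj a).arg * I)
  have hreal : c * (b - conj a) = ‖b - conj a‖ := by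
    conv_lhs => rw [← Complex.norm_mul_exp_arg_mul_I (b - conj a)]
    rw [mul_left_comm, ← Complex.exp_add, neg_mul, neg_add_cancel, Complex.exp_zero, mul_one]
  have him := congr(($hreal).im)
  simp only [Complex.mul_im, Complex.sub_re, Complex.sub_im, Complex.conj_re, Complex.conj_im,
    Complex.ofReal_im, Complex.add_im] at him ⊢
  linarith

theorem ofReal_mem_numRange_of_mem_Icc {S : H →L[ℂ] H} {x y : H} (hx : ‖x‖ = 1) (hy : ‖y‖ = 1)
    (hxS : ⟪x, S x⟫_ℂ = 0) (hyS : ⟪y, S y⟫_ℂ = 1) {s : ℝ} (hs : s ∈ Set.Icc 0 1) :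
    (s : ℂ) ∈ numRange S := by
  obtain ⟨c, hc, him⟩ :=
    exists_norm_eq_one_im_conj_mul_add_mul_eq_zero ⟪x, S y⟫_ℂ ⟪y, S x⟫_ℂ
  set κ := (conj c * ⟪x, S y⟫_ℂ + c * ⟪y, S x⟫_ℂ).re
  have hκ : conj c * ⟪x, S y⟫_ℂ + c * ⟪y, S x⟫_ℂ = κ := Complex.ext rfl him
  set z : ℝ → H := fun t => ((1 - t : ℝ) : ℂ) • c • x + (t : ℂ) • y
  have hzS (t : ℝ) : ⟪z t, S (z t)⟫_ℂ = (t ^ 2 + t * (1 - t) * κ : ℝ) := by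
    simp only [z, map_add, map_smul, inner_add_left, inner_add_right, inner_smul_left,
      inner_smul_right, Complex.conj_ofReal, hxS, hyS]
    push_cast
    rw [← hκ]
    ring
  have hz0 (t : ℝ) : z t ≠ 0 := by
    intro h0
    have hty : (t : ℂ) • y = -(((1 - t : ℝ) : ℂ) • c • x) :=
      eq_neg_of_add_eq_zero_right h0
    have hinner : ⟪(t : ℂ) • y, S ((t : ℂ) • y)⟫_ℂ = 0 := by
      rw [hty]
      simp [inner_smul_left, inner_smul_right, hxS]
    have ht : t = 0 := by simpa [inner_smul_left, inner_smul_right, hyS] using hinner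
    have hcx : ‖c • x‖ = 1 := by rw [norm_smul, hc, hx, one_mul]
    exact norm_ne_zero_iff.1 (hcx.trans_ne one_ne_zero) (by simpa [ht] using hty)
  have hcont : Continuous fun t : ℝ => (t ^ 2 + t * (1 - t) * κ) / ‖z t‖ ^ 2 :=
    Continuous.div₀ (by fun_prop) (by fun_prop) fun t => pow_ne_zero 2 (norm_ne_zero_iff.2 (hz0 t))
  obtain ⟨t, -, ht⟩ := intermediate_value_Icc zero_le_one hcont.continuousOn
    (by simpa [z, hy] using hs : s ∈ Set.Icc _ _)
  obtain ⟨w, hw, hwt⟩ := exists_mem_numRange_inner_eq S (hz0 t)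
  have hnorm : ((‖z t‖ ^ 2 : ℝ) : ℂ) ≠ 0 := mod_cast pow_ne_zero 2 (norm_ne_zero_iff.2 (hz0 t))
  rwa [← ht, Complex.ofReal_div, ← hzS, hwt, mul_div_cancel_left₀ _ hnorm]

/-- The Toeplitz–Hausdorff theorem. -/
theorem convex_numRange (T : H →L[ℂ] H) : Convex ℝ (numRange T) := by
  rw [convex_iff_segment_subset]
  rintro _ ⟨x, hx, rfl⟩ _ ⟨y, hy, rfl⟩
  dsimp only
  rw [mem_sphere_zero_iff_norm] at hx hy
  set a := ⟪x, T x⟫_ℂ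
  set b := ⟪y, T y⟫_ℂ
  by_cases hab : a = b
  · rw [← hab, segment_same, Set.singleton_subset_iff]
    exact ⟨x, mem_sphere_zero_iff_norm.2 hx, rfl⟩
  have hba : b - a ≠ 0 := sub_ne_zero.2 (Ne.symm hab)
  set S : H →L[ℂ] H := (b - a)⁻¹ • (T - a • 1)
  have hS {z : H} (hz : ‖z‖ = 1) : ⟪z, S z⟫_ℂ = (b - a)⁻¹ * (⟪z, T z⟫_ℂ - a) := by
    simp [S, inner_self_eq_norm_sq_to_K, hz]
  rw [segment_eq_image']
  rintro _ ⟨s, hs, rfl⟩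
  obtain ⟨z, hz, hzs⟩ := ofReal_mem_numRange_of_mem_Icc hx hy
    (by rw [hS hx, sub_self, mul_zero]) (by rw [hS hy, inv_mul_cancel₀ hba]) hs
  refine ⟨z, hz, ?_⟩
  dsimp only at hzs ⊢
  rw [Complex.real_smul, ← hzs, hS (mem_sphere_zero_iff_norm.1 hz)]
  field_simp
  ring

theorem isCompact_numRange [FiniteDimensional ℂ H] (T : H →L[ℂ] H) : IsCompact (numRange T) :=
  haveI := FiniteDimensional.proper ℂ H
  (isCompact_sphere _ _).image (by fun_prop)

theorem numRange_neg (T : H →L[ℂ] H) : numRange (-T) = -numRange T := by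
  simp only [numRange, ← Set.image_neg_eq_neg, Set.image_image, neg_apply, inner_neg_right]

end ToeplitzHausdorff

section Submatrix

variable {𝕜 : Type*} [RCLike 𝕜] {ι κ m n : Type*} [Fintype n] [DecidableEq n]

/-- The `0`-`1` matrix of the coordinate embedding along `e`: multiplying by it on the right
selects columns, and multiplying by its conjugate transpose on the left selects rows. -/
def coordEmbedding (𝕜 : Type*) [RCLike 𝕜] (e : ι → n) : Matrix n ι 𝕜 :=
  (1 : Matrix n n 𝕜).submatrix id e

theorem submatrix_eq_coordEmbedding_mul [Fintype m] [DecidableEq m] (M : Matrix m n 𝕜)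
    (e₁ : ι → m) (e₂ : κ → n) :
    M.submatrix e₁ e₂ = (coordEmbedding 𝕜 e₁).conjTranspose * M * coordEmbedding 𝕜 e₂ := by
  ext i j
  simp [coordEmbedding, Matrix.mul_apply, Matrix.one_apply]

theorem conjTranspose_coordEmbedding_mul_self [DecidableEq ι] {e : ι → n}
    (he : Function.Injective e) :
    (coordEmbedding 𝕜 e).conjTranspose * coordEmbedding 𝕜 e = 1 := by
  simpa [Matrix.submatrix_one _ he] using
    (submatrix_eq_coordEmbedding_mul (𝕜 := 𝕜) 1 e e).symm

theorem norm_coordEmbedding_le [Fintype ι] [DecidableEq ι] {e : ι → n} (he : Function.Injective e) :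
    ‖coordEmbedding 𝕜 e‖ ≤ 1 := by
  have hsq : ‖coordEmbedding 𝕜 e‖ * ‖coordEmbedding 𝕜 e‖ ≤ 1 := by
    rw [← Matrix.l2_opNorm_conjTranspose_mul_self, conjTranspose_coordEmbedding_mul_self he,
      ← Matrix.diagonal_one, Matrix.l2_opNorm_diagonal]
    exact (pi_norm_le_iff_of_nonneg zero_le_one).2 fun _ => norm_one.le
  nlinarith [norm_nonneg (coordEmbedding 𝕜 e)]

theorem l2_opNorm_submatrix_le [Fintype ι] [Fintype κ] [DecidableEq κ] [Fintype m]
    (M : Matrix m n 𝕜) {e₁ : ι → m} {e₂ : κ → n} (he₁ : Function.Injective e₁)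
    (he₂ : Function.Injective e₂) : ‖M.submatrix e₁ e₂‖ ≤ ‖M‖ := by
  classical
  rw [submatrix_eq_coordEmbedding_mul]
  calc ‖(coordEmbedding 𝕜 e₁).conjTranspose * M * coordEmbedding 𝕜 e₂‖
      ≤ ‖coordEmbedding 𝕜 e₁‖ * ‖M‖ * ‖coordEmbedding 𝕜 e₂‖ := by
        refine (Matrix.l2_opNorm_mul _ _).trans ?_
        gcongr
        exact (Matrix.l2_opNorm_mul _ _).trans_eq (by rw [Matrix.l2_opNorm_conjTranspose])
    _ ≤ 1 * ‖M‖ * 1 := by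
        gcongr
        exacts [norm_coordEmbedding_le he₁, norm_coordEmbedding_le he₂]
    _ = ‖M‖ := by rw [one_mul, mul_one]

theorem inner_toEuclideanCLM_conjTranspose_mul_mul [Fintype ι] [DecidableEq ι]
    (P : Matrix n ι 𝕜) (M : Matrix n n 𝕜) (x : EuclideanSpace 𝕜 ι) :
    ⟪x, Matrix.toEuclideanCLM (𝕜 := 𝕜) (P.conjTranspose * M * P) x⟫_𝕜 =
      ⟪Matrix.toEuclideanLin P x,
        Matrix.toEuclideanCLM (𝕜 := 𝕜) M (Matrix.toEuclideanLin P x)⟫_𝕜 := by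
  rw [← LinearMap.adjoint_inner_right, ← Matrix.toEuclideanLin_conjTranspose_eq_adjoint]
  congr 1
  ext i
  simp [Matrix.mulVec_mulVec, Matrix.mul_assoc]

theorem norm_toEuclideanLin_coordEmbedding [Fintype ι] [DecidableEq ι] {e : ι → n}
    (he : Function.Injective e) (x : EuclideanSpace 𝕜 ι) :
    ‖Matrix.toEuclideanLin (coordEmbedding 𝕜 e) x‖ = ‖x‖ := by
  have h := inner_toEuclideanCLM_conjTranspose_mul_mul (coordEmbedding 𝕜 e) 1 x
  rw [Matrix.mul_one, conjTranspose_coordEmbedding_mul_self he] at h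
  simp only [map_one, one_apply_eq_self, inner_self_eq_norm_sq_to_K] at h
  exact (sq_eq_sq₀ (norm_nonneg _) (norm_nonneg _)).1 (mod_cast h.symm)

theorem numRange_submatrix_subset [Fintype ι] [DecidableEq ι] (M : Matrix n n ℂ) {e : ι → n}
    (he : Function.Injective e) :
    numRange (Matrix.toEuclideanCLM (𝕜 := ℂ) (M.submatrix e e)) ⊆
      numRange (Matrix.toEuclideanCLM (𝕜 := ℂ) M) := by
  rintro _ ⟨x, hx, rfl⟩
  refine ⟨Matrix.toEuclideanLin (coordEmbedding ℂ e) x, ?_, ?_⟩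
  · rwa [mem_sphere_zero_iff_norm, norm_toEuclideanLin_coordEmbedding he,
      ← mem_sphere_zero_iff_norm]
  · dsimp only
    rw [submatrix_eq_coordEmbedding_mul, inner_toEuclideanCLM_conjTranspose_mul_mul]

end Submatrix

section Hermitian

variable {𝕜 : Type*} [RCLike 𝕜] {n : Type*} [Fintype n] [DecidableEq n]

theorem l2_opNorm_eq_norm_eigenvalues {X : Matrix n n 𝕜} (hX : X.IsHermitian) :
    ‖X‖ = ‖hX.eigenvalues‖ := by
  conv_lhs => rw [hX.spectral_theorem, Unitary.conjStarAlgAut_apply, ← Unitary.coe_star,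
    CStarRing.norm_mul_coe_unitary, CStarRing.norm_coe_unitary_mul, Matrix.l2_opNorm_diagonal]
  exact congrArg NNReal.toReal (Finset.sup_congr rfl fun i _ => nnnorm_algebraMap' 𝕜 _)

open scoped MatrixOrder in
theorem numRange_map_ofReal_subset_of_posSemidef {X : Matrix n n ℝ} (hX : X.PosSemidef) :
    numRange (Matrix.toEuclideanCLM (𝕜 := ℂ) (X.map Complex.ofReal)) ⊆
      Complex.ofReal '' Set.Icc 0 ‖X‖ := by
  obtain ⟨B, rfl⟩ := CStarAlgebra.nonneg_iff_eq_star_mul_self.1 hX.nonneg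
  have hmap : (star B * B).map Complex.ofReal =
      (B.map Complex.ofReal).conjTranspose * 1 * B.map Complex.ofReal := by
    ext i j
    simp [Matrix.mul_apply]
  rintro _ ⟨x, hx, rfl⟩
  refine ⟨‖Matrix.toEuclideanLin (B.map Complex.ofReal) x‖ ^ 2, ⟨by positivity, ?_⟩, ?_⟩
  · calc ‖Matrix.toEuclideanLin (B.map Complex.ofReal) x‖ ^ 2 ≤ (‖B‖ * ‖x‖) ^ 2 := by
          gcongr
          exact norm_toEuclideanLin_map_le B x
      _ = ‖star B * B‖ := by
          rw [mem_sphere_zero_iff_norm.1 hx, mul_one, sq, CStarRing.norm_star_mul_self]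
  · dsimp only
    rw [hmap, inner_toEuclideanCLM_conjTranspose_mul_mul, map_one, one_apply_eq_self,
      inner_self_eq_norm_sq_to_K]
    simp

end Hermitian

/-! ### The Riccati equation -/

section Riccati

variable {n : ℕ} {A B Q X : Matrix (Fin n) (Fin n) ℝ}

theorem numericalRange_eq_numRange (A : Matrix (Fin n) (Fin n) ℝ) :
    numericalRange A = numRange (Matrix.toEuclideanCLM (𝕜 := ℂ) (A.map Complex.ofReal)) := by
  ext z
  simp only [numericalRange, numRange, Set.mem_image, mem_sphere_zero_iff_norm,
    EuclideanSpace.inner_eq_star_dotProduct, Matrix.ofLp_toEuclideanCLM, dotProduct_comm,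
    eq_comm (a := z), Set.mem_ofPred_eq]

theorem isCompact_numericalRange (A : Matrix (Fin n) (Fin n) ℝ) : IsCompact (numericalRange A) := by
  rw [numericalRange_eq_numRange]
  exact isCompact_numRange _

theorem convex_numericalRange (A : Matrix (Fin n) (Fin n) ℝ) : Convex ℝ (numericalRange A) := by
  rw [numericalRange_eq_numRange]
  exact convex_numRange _

theorem numericalRange_transpose_subset (A : Matrix (Fin n) (Fin n) ℝ) :
    numericalRange A.transpose ⊆ numericalRange A := by
  rintro _ ⟨x, hx, rfl⟩
  refine ⟨WithLp.toLp 2 (star x.ofLp), by simpa [EuclideanSpace.norm_eq] using hx, ?_⟩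
  rw [star_star, Matrix.transpose_map, Matrix.dotProduct_mulVec, Matrix.vecMul_transpose,
    dotProduct_comm]

theorem ofReal_dotProduct_mulVec_mem_numericalRange (A : Matrix (Fin n) (Fin n) ℝ)
    {v : EuclideanSpace ℝ (Fin n)} (hv : ‖v‖ = 1) :
    ((v.ofLp ⬝ᵥ A.mulVec v.ofLp : ℝ) : ℂ) ∈ numericalRange A :=
  ⟨WithLp.toLp 2 fun i => (v i : ℂ), by simpa [EuclideanSpace.norm_eq] using hv,
    by simp [dotProduct, Matrix.mulVec]⟩

theorem exists_ofReal_mem_numericalRange [NeZero n] (A : Matrix (Fin n) (Fin n) ℝ) :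
    ∃ x : ℝ, (x : ℂ) ∈ numericalRange A :=
  let ⟨_, hv⟩ := exists_norm_eq (EuclideanSpace ℝ (Fin n)) zero_le_one
  ⟨_, ofReal_dotProduct_mulVec_mem_numericalRange A hv⟩

theorem numericalRangeTau_pos [NeZero n] (hA : numericalRange A ⊆ {z : ℂ | z.re < 0}) :
    0 < numericalRangeTau A := by
  obtain ⟨x, hx⟩ := exists_ofReal_mem_numericalRange A
  have hbdd : BddBelow {x : ℝ | (x : ℂ) ∈ numericalRange A} := by
    obtain ⟨R, hR⟩ := (isCompact_numericalRange A).isBounded.exists_norm_le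
    refine ⟨-R, fun y hy => (abs_le.1 ?_).1⟩
    simpa using hR _ hy
  have hneg : x < 0 := hA hx
  exact abs_pos.2 ((csInf_le hbdd hx).trans_lt hneg).ne

theorem isCompact_decaySet (A Q : Matrix (Fin n) (Fin n) ℝ) : IsCompact (decaySet A Q) :=
  (isCompact_numericalRange A).add (isCompact_Icc.image Complex.continuous_ofReal)

theorem convex_decaySet (A Q : Matrix (Fin n) (Fin n) ℝ) : Convex ℝ (decaySet A Q) :=
  (convex_numericalRange A).add ((convex_Icc _ _).linear_image Complex.ofRealCLM.toLinearMap)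

theorem infinite_decaySet [NeZero n] (hA : numericalRange A ⊆ {z : ℂ | z.re < 0})
    (Q : Matrix (Fin n) (Fin n) ℝ) : (decaySet A Q).Infinite := by
  have hτ := numericalRangeTau_pos hA
  have hlt : -numericalRangeTau A - √(numericalRangeTau A ^ 2 + ‖Q‖) < 0 := by
    linarith [Real.sqrt_nonneg (numericalRangeTau A ^ 2 + ‖Q‖)]
  obtain ⟨x, hx⟩ := exists_ofReal_mem_numericalRange A
  exact Set.infinite_add.2 <| .inr ⟨(Set.Icc_infinite hlt).image Complex.ofReal_injective.injOn,
    _, hx⟩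

/-- Test the Riccati equation with an eigenvector of `X`. -/
theorem SolvesRiccati.sq_eigenvalue_le (hA : numericalRange A ⊆ {z : ℂ | z.re < 0})
    (hX : X.IsHermitian) (hcare : SolvesRiccati A 1 Q X) {l : ℝ} (hl : 0 ≤ l)
    {v : EuclideanSpace ℝ (Fin n)} (hv : ‖v‖ = 1) (hXv : X.mulVec v.ofLp = l • v.ofLp) :
    l ^ 2 ≤ ‖Q‖ := by
  have hvX : Matrix.vecMul v.ofLp X = l • v.ofLp := by
    rw [← hXv, ← Matrix.vecMul_transpose]
    exact congrArg _ hX.symm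
  have hvv : v.ofLp ⬝ᵥ v.ofLp = 1 := by
    have hinner := real_inner_self_eq_norm_sq v
    rwa [hv, one_pow, EuclideanSpace.inner_eq_star_dotProduct, star_trivial] at hinner
  have hneg : v.ofLp ⬝ᵥ A.mulVec v.ofLp < 0 :=
    hA (ofReal_dotProduct_mulVec_mem_numericalRange A hv)
  have htranspose : v.ofLp ⬝ᵥ A.transpose.mulVec v.ofLp = v.ofLp ⬝ᵥ A.mulVec v.ofLp := by
    rw [Matrix.dotProduct_mulVec, Matrix.vecMul_transpose, dotProduct_comm]
  have hQ : v.ofLp ⬝ᵥ Q.mulVec v.ofLp ≤ ‖Q‖ := by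
    rw [← Matrix.inner_toEuclideanCLM]
    refine (real_inner_le_norm _ _).trans ?_
    simpa only [hv, one_mul, mul_one, Matrix.l2_opNorm_toEuclideanCLM] using
      (Matrix.toEuclideanCLM (𝕜 := ℝ) Q).le_opNorm v
  have hquadratic :
      2 * l * (v.ofLp ⬝ᵥ A.mulVec v.ofLp) - l ^ 2 + v.ofLp ⬝ᵥ Q.mulVec v.ofLp = 0 := by
    have htest := congr(v.ofLp ⬝ᵥ ($hcare).mulVec v.ofLp)
    simp only [Matrix.add_mulVec, Matrix.sub_mulVec, ← Matrix.mulVec_mulVec, Matrix.mul_one,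
      Matrix.zero_mulVec, dotProduct_add, dotProduct_sub, dotProduct_zero, hXv,
      Matrix.mulVec_smul, dotProduct_smul, htranspose, Matrix.dotProduct_mulVec v.ofLp X, hvX,
      smul_dotProduct, hvv, smul_eq_mul] at htest
    linarith
  nlinarith

theorem SolvesRiccati.norm_le (hA : numericalRange A ⊆ {z : ℂ | z.re < 0}) (hX : X.PosSemidef)
    (hcare : SolvesRiccati A 1 Q X) : ‖X‖ ≤ √‖Q‖ := by
  rw [l2_opNorm_eq_norm_eigenvalues hX.isHermitian,
    pi_norm_le_iff_of_nonneg (Real.sqrt_nonneg _)]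
  intro i
  rw [Real.norm_of_nonneg (hX.eigenvalues_nonneg i)]
  exact Real.le_sqrt_of_sq_le (hcare.sq_eigenvalue_le hA hX.isHermitian (hX.eigenvalues_nonneg i)
    (hX.isHermitian.eigenvectorBasis.norm_eq_one i) (hX.isHermitian.mulVec_eigenvectorBasis i))

theorem numericalRange_sub_subset_decaySet (hA : numericalRange A ⊆ {z : ℂ | z.re < 0})
    (hX : X.PosSemidef) (hcare : SolvesRiccati A 1 Q X)
    (hB : numericalRange B ⊆ numericalRange A) : numericalRange (B - X) ⊆ decaySet A Q := by
  rw [numericalRange_eq_numRange B] at hB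
  rw [numericalRange_eq_numRange, Matrix.map_sub _ Complex.ofReal_sub, map_sub]
  rintro _ ⟨x, hx, rfl⟩
  obtain ⟨r, hr, hrx⟩ := numRange_map_ofReal_subset_of_posSemidef hX ⟨x, hx, rfl⟩
  have hnorm : ‖X‖ ≤ numericalRangeTau A + √(numericalRangeTau A ^ 2 + ‖Q‖) :=
    calc ‖X‖ ≤ √‖Q‖ := hcare.norm_le hA hX
      _ ≤ √(numericalRangeTau A ^ 2 + ‖Q‖) :=
        Real.sqrt_le_sqrt (le_add_of_nonneg_left (sq_nonneg _))
      _ ≤ _ := le_add_of_nonneg_left (abs_nonneg _)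
  refine ⟨_, hB ⟨x, hx, rfl⟩, _, ⟨-r, ⟨by linarith [hr.2], neg_nonpos.2 hr.1⟩, rfl⟩, ?_⟩
  dsimp only at hrx ⊢
  rw [Complex.ofReal_neg, hrx, sub_apply, inner_sub_right, sub_eq_add_neg]

end Riccati

/-! ### Zolotarev numbers -/

section Zolotarev

open Polynomial

variable {h : ℕ} {E G : Set ℂ} {g : RatFunc ℂ}

theorem zolotarevNumber_ne_top (h : ℕ) (E G : Set ℂ) : zolotarevNumber h E G ≠ ⊤ := by
  have hmem : (1 : RatFunc ℂ) ∈ zolotarevAdmissible h E G := by simp [zolotarevAdmissible]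
  refine ne_top_of_le_ne_top ENNReal.one_ne_top ((iInf₂_le 1 hmem).trans ?_)
  have hone (z : ℂ) : ratFuncModulus 1 z = 1 := by simp [ratFuncModulus]
  simp only [hone]
  refine ENNReal.div_le_of_le_mul ?_
  rw [one_mul]
  exact (iSup₂_le fun _ _ => le_rfl).trans (le_iInf₂ fun _ _ => le_rfl)

theorem iInf_ratFuncModulus_ne_top (hG : G.Infinite) (g : RatFunc ℂ) :
    ⨅ z ∈ G, ratFuncModulus g z ≠ ⊤ := by
  obtain ⟨z, hzG, hz⟩ := hG.exists_notMem_finset g.denom.roots.toFinset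
  have hz0 : g.denom.eval z ≠ 0 := by simpa [g.denom_ne_zero] using hz
  exact ne_top_of_le_ne_top (ENNReal.div_ne_top enorm_ne_top (enorm_ne_zero.2 hz0))
    (iInf₂_le z hzG)

theorem enorm_eval_num_le (hden : ∀ z ∈ E, g.denom.eval z ≠ 0) {z : ℂ} (hz : z ∈ E) :
    ‖g.num.eval z‖ₑ ≤ (⨆ z ∈ E, ratFuncModulus g z) * ‖g.denom.eval z‖ₑ :=
  (ENNReal.div_le_iff (enorm_ne_zero.2 (hden z hz)) enorm_ne_top).1
    (le_iSup₂ (f := fun z _ => ratFuncModulus g z) z hz)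

theorem iInf_ratFuncModulus_ne_zero (hE : E.Infinite) (hG : G.Nonempty)
    (hg : g ∈ zolotarevAdmissible h E G)
    (hfin : (⨆ z ∈ E, ratFuncModulus g z) / (⨅ z ∈ G, ratFuncModulus g z) ≠ ⊤) :
    ⨅ z ∈ G, ratFuncModulus g z ≠ 0 := by
  obtain ⟨-, -, hden, hnum⟩ := hg
  intro hinf
  have hsup : ⨆ z ∈ E, ratFuncModulus g z = 0 := by
    by_contra hsup
    exact hfin (by rw [hinf, ENNReal.div_zero hsup])
  have hroot : ∀ z ∈ E, g.num.IsRoot z := fun z hz => by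
    simpa [hsup] using enorm_eval_num_le hden hz
  obtain ⟨z, hz⟩ := hG
  refine hnum z hz ?_
  rw [eq_zero_of_infinite_isRoot _ (hE.mono hroot), eval_zero]

theorem exists_polynomial_of_zolotarevNumber_lt (hE : E.Infinite) (hG : G.Infinite) {c : ℝ}
    (hc : (zolotarevNumber h E G).toReal < c) :
    ∃ p q : ℂ[X], p.natDegree ≤ h ∧ q.natDegree ≤ h ∧
      (∀ z ∈ E, q.eval z ≠ 0) ∧ (∀ z ∈ G, p.eval z ≠ 0) ∧
      (∀ z ∈ E, ‖p.eval z‖ ≤ c * ‖q.eval z‖) ∧ ∀ z ∈ G, ‖q.eval z‖ ≤ ‖p.eval z‖ := by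
  have hc0 : 0 ≤ c := ENNReal.toReal_nonneg.trans hc.le
  rw [← ENNReal.lt_ofReal_iff_toReal_lt (zolotarevNumber_ne_top h E G)] at hc
  simp only [zolotarevNumber, iInf_lt_iff] at hc
  obtain ⟨g, hg, hlt⟩ := hc
  have hm0 := iInf_ratFuncModulus_ne_zero hE hG.nonempty hg hlt.ne_top
  have hmtop := iInf_ratFuncModulus_ne_top hG g
  obtain ⟨hnum_deg, hden_deg, hden, hnum⟩ := hg
  set m := ⨅ z ∈ G, ratFuncModulus g z
  set q := C (m.toReal : ℂ) * g.denom
  have hq (z : ℂ) : ‖q.eval z‖ₑ = m * ‖g.denom.eval z‖ₑ := by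
    rw [eval_mul, eval_C, enorm_mul, ← ofReal_norm (m.toReal : ℂ),
      Complex.norm_of_nonneg ENNReal.toReal_nonneg, ENNReal.ofReal_toReal hmtop]
  refine ⟨g.num, q, hnum_deg, (natDegree_C_mul_le _ _).trans hden_deg, fun z hz => ?_, hnum,
    fun z hz => ?_, fun z hz => ?_⟩
  · rw [← enorm_ne_zero, hq]
    exact mul_ne_zero hm0 (enorm_ne_zero.2 (hden z hz))
  · have henorm : ‖g.num.eval z‖ₑ ≤ ENNReal.ofReal c * ‖q.eval z‖ₑ :=
      calc ‖g.num.eval z‖ₑ ≤ (⨆ z ∈ E, ratFuncModulus g z) * ‖g.denom.eval z‖ₑ :=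
            enorm_eval_num_le hden hz
        _ ≤ ENNReal.ofReal c * m * ‖g.denom.eval z‖ₑ := by
            gcongr
            exact (ENNReal.div_le_iff hm0 hmtop).1 hlt.le
        _ = ENNReal.ofReal c * ‖q.eval z‖ₑ := by rw [hq, mul_assoc]
    simpa [hc0] using
      ENNReal.toReal_mono (ENNReal.mul_ne_top ENNReal.ofReal_ne_top enorm_ne_top) henorm
  · rw [← enorm_le_iff_norm_le, hq]
    exact ENNReal.mul_le_of_le_div (iInf₂_le z hz)

theorem singularValue_le_norm {ι κ : Type*} [Fintype ι] [Fintype κ] [DecidableEq κ]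
    (M : Matrix ι κ ℝ) (k : ℕ) : singularValue M (k + 1) ≤ ‖M‖ :=
  singularValue_le_of_norm_le_on_ker (norm_nonneg M) (0 : _ →ₗ[ℂ] PUnit)
    (Module.finrank_zero_of_subsingleton.trans_le k.zero_le)
    fun w _ => norm_toEuclideanLin_map_le M w

theorem singularValue_antitone {ι κ : Type*} [Fintype ι] [Fintype κ] [DecidableEq κ]
    (M : Matrix ι κ ℝ) : Antitone (singularValue M) := fun _ _ hkl =>
  (Matrix.toEuclideanLin M).singularValues_antitone (Nat.sub_le_sub_right hkl 1)

variable {ι κ : Type*} [Fintype ι] [DecidableEq ι] [Fintype κ] [DecidableEq κ]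

/-- Applying `singularValue_le_of_sylvester` to `g ^ 2` turns its bound `9 * c` into
`min 1 (9 * c ^ 2) ≤ 3 * c`, at the price of doubling the degree. -/
theorem singularValue_le_zolotarevNumber {L : Matrix ι ι ℝ} {N : Matrix κ κ ℝ}
    (M : Matrix ι κ ℝ) (hE : IsCompact E) (hEc : Convex ℝ E) (hEi : E.Infinite)
    (hG : IsCompact G) (hGc : Convex ℝ G) (hGi : G.Infinite)
    (hL : numRange (Matrix.toEuclideanCLM (𝕜 := ℂ) (L.map Complex.ofReal)) ⊆ E)
    (hN : numRange (Matrix.toEuclideanCLM (𝕜 := ℂ) (N.map Complex.ofReal)) ⊆ G) (h : ℕ) :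
    singularValue M (2 * h * (L * M - M * N).rank + 1) ≤
      3 * (zolotarevNumber h E G).toReal * ‖M‖ := by
  set σ := singularValue M (2 * h * (L * M - M * N).rank + 1)
  suffices hσ : ∀ c > (zolotarevNumber h E G).toReal, σ ≤ 3 * c * ‖M‖ by
    have hcont : Continuous fun c : ℝ => 3 * c * ‖M‖ := by fun_prop
    exact ge_of_tendsto (hcont.continuousWithinAt (s := Set.Ioi (zolotarevNumber h E G).toReal))
      (eventually_mem_nhdsWithin.mono hσ)
  intro c hc
  have hc0 : 0 ≤ c := ENNReal.toReal_nonneg.trans hc.le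
  rcases le_total 1 (3 * c) with hone | hone
  · exact (singularValue_le_norm M _).trans (le_mul_of_one_le_left (norm_nonneg M) hone)
  obtain ⟨p, q, hp, hq, hq0, hp0, hpq, hqp⟩ := exists_polynomial_of_zolotarevNumber_lt hEi hGi hc
  calc σ ≤ 9 * c ^ 2 * ‖M‖ :=
        singularValue_le_of_sylvester M hE hEc hEi.nonempty hG hGc hGi.nonempty hL hN
          (p := p ^ 2) (q := q ^ 2) (natDegree_pow_le.trans (by gcongr))
          (natDegree_pow_le.trans (by gcongr))
          (fun z hz => by simpa using hq0 z hz) (fun z hz => by simpa using hp0 z hz)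
          (sq_nonneg c)
          (fun z hz => by
            simpa only [eval_pow, norm_pow, mul_pow] using
              pow_le_pow_left₀ (norm_nonneg _) (hpq z hz) 2)
          (fun z hz => by
            simpa only [eval_pow, norm_pow] using pow_le_pow_left₀ (norm_nonneg _) (hqp z hz) 2)
    _ = 3 * c * (3 * c) * ‖M‖ := by ring
    _ ≤ 3 * c * ‖M‖ := mul_le_mul_of_nonneg_right
        (mul_le_of_le_one_right (by positivity) hone) (norm_nonneg M)

end Zolotarev

/-! ### Offdiagonal blocks of the solution of the Riccati equation -/

section Blocks

theorem matrix_rank_add_le {K ι κ : Type*} [Field K] [Finite ι] [Fintype κ] (Y Z : Matrix ι κ K) :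
    (Y + Z).rank ≤ Y.rank + Z.rank := by
  rw [Matrix.rank, Matrix.mulVecLin_add]
  exact (Submodule.finrank_mono (LinearMap.range_add_le _ _)).trans
    (Submodule.finrank_add_le_finrank_add_finrank _ _)

theorem submatrix_mul_of_bijective_sumElim {R l m n o p ι κ : Type*} [NonUnitalNonAssocSemiring R]
    [Fintype n] [Fintype ι] [Fintype κ] {e₁ : ι → n} {e₂ : κ → n}
    (he : Function.Bijective (Sum.elim e₁ e₂)) (Y : Matrix m n R) (Z : Matrix n o R)
    (f : l → m) (g : p → o) :
    (Y * Z).submatrix f g =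
      Y.submatrix f e₁ * Z.submatrix e₁ g + Y.submatrix f e₂ * Z.submatrix e₂ g := by
  ext i j
  simp only [Matrix.submatrix_apply, Matrix.mul_apply, Matrix.add_apply]
  rw [← he.sum_comp fun k => Y (f i) k * Z k (g j), Fintype.sum_sum_type]
  simp only [Sum.elim_inl, Sum.elim_inr]

variable {n : ℕ} {A Q X : Matrix (Fin n) (Fin n) ℝ} {ι κ : Type*} [Fintype ι] [Fintype κ]
  {e₁ : ι → Fin n} {e₂ : κ → Fin n}

theorem numRange_map_submatrix_subset [DecidableEq ι] (B : Matrix (Fin n) (Fin n) ℝ)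
    (he₁ : Function.Injective e₁) :
    numRange (Matrix.toEuclideanCLM (𝕜 := ℂ) ((B.submatrix e₁ e₁).map Complex.ofReal)) ⊆
      numericalRange B := by
  rw [← Matrix.submatrix_map, numericalRange_eq_numRange]
  exact numRange_submatrix_subset _ he₁

theorem SolvesRiccati.sylvester_submatrix (hcare : SolvesRiccati A 1 Q X)
    (he : Function.Bijective (Sum.elim e₁ e₂)) :
    (A.transpose - X).submatrix e₁ e₁ * X.submatrix e₁ e₂ -
        X.submatrix e₁ e₂ * (-(A - X)).submatrix e₂ e₂ =
      -(A.transpose.submatrix e₁ e₂ * X.submatrix e₂ e₂ +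
        X.submatrix e₁ e₁ * A.submatrix e₁ e₂ + Q.submatrix e₁ e₂) := by
  have hblock := congr(($hcare).submatrix e₁ e₂)
  simp only [Matrix.mul_one, Matrix.submatrix_add, Matrix.submatrix_sub, Pi.add_apply,
    Pi.sub_apply, submatrix_mul_of_bijective_sumElim he, Matrix.submatrix_zero,
    Pi.zero_apply] at hblock
  rw [eq_neg_iff_add_eq_zero, ← hblock]
  simp only [Matrix.submatrix_sub, Matrix.submatrix_neg, Pi.sub_apply, Pi.neg_apply,
    Matrix.sub_mul, Matrix.mul_sub, Matrix.mul_neg]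
  abel

theorem SolvesRiccati.rank_sylvester_submatrix_le (hcare : SolvesRiccati A 1 Q X)
    (he : Function.Bijective (Sum.elim e₁ e₂)) {ra rq : ℕ}
    (hA₁₂ : (A.submatrix e₁ e₂).rank ≤ ra) (hA₂₁ : (A.submatrix e₂ e₁).rank ≤ ra)
    (hQ₁₂ : (Q.submatrix e₁ e₂).rank ≤ rq) :
    ((A.transpose - X).submatrix e₁ e₁ * X.submatrix e₁ e₂ -
      X.submatrix e₁ e₂ * (-(A - X)).submatrix e₂ e₂).rank ≤ 2 * ra + rq := by
  have htranspose : (A.transpose.submatrix e₁ e₂ * X.submatrix e₂ e₂).rank ≤ ra := by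
    refine (Matrix.rank_mul_le_left _ _).trans ?_
    rwa [← Matrix.transpose_submatrix, Matrix.rank_transpose]
  have hmul := (Matrix.rank_mul_le_right (X.submatrix e₁ e₁) (A.submatrix e₁ e₂)).trans hA₁₂
  rw [hcare.sylvester_submatrix he, ← neg_one_smul ℝ,
    Matrix.rank_smul_of_mem_nonZeroDivisors _ isUnit_one.neg.mem_nonZeroDivisors]
  calc _ ≤ _ := matrix_rank_add_le _ _
    _ ≤ _ := add_le_add (matrix_rank_add_le _ _) hQ₁₂
    _ ≤ 2 * ra + rq := by omega

theorem SolvesRiccati.singularValue_submatrix_le [NeZero n] [DecidableEq κ]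
    (hA : numericalRange A ⊆ {z : ℂ | z.re < 0}) (hX : X.PosSemidef)
    (hcare : SolvesRiccati A 1 Q X) (he : Function.Bijective (Sum.elim e₁ e₂)) {ra rq : ℕ}
    (hA₁₂ : (A.submatrix e₁ e₂).rank ≤ ra) (hA₂₁ : (A.submatrix e₂ e₁).rank ≤ ra)
    (hQ₁₂ : (Q.submatrix e₁ e₂).rank ≤ rq) (h : ℕ) :
    singularValue (X.submatrix e₁ e₂) (h * (4 * ra + 2 * rq) + 1) ≤
      3 * (zolotarevNumber h (decaySet A Q) (-decaySet A Q)).toReal * ‖X‖ := by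
  classical
  have he₁ : Function.Injective e₁ := he.injective.comp Sum.inl_injective
  have he₂ : Function.Injective e₂ := he.injective.comp Sum.inr_injective
  have hcompact := isCompact_decaySet A Q
  have hconvex := convex_decaySet A Q
  have hinf := infinite_decaySet hA Q
  have hL : numRange (Matrix.toEuclideanCLM (𝕜 := ℂ)
      (((A.transpose - X).submatrix e₁ e₁).map Complex.ofReal)) ⊆ decaySet A Q :=
    (numRange_map_submatrix_subset _ he₁).trans <|
      numericalRange_sub_subset_decaySet hA hX hcare (numericalRange_transpose_subset A)
  have hN : numRange (Matrix.toEuclideanCLM (𝕜 := ℂ)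
      (((-(A - X)).submatrix e₂ e₂).map Complex.ofReal)) ⊆ -decaySet A Q := by
    refine (numRange_map_submatrix_subset _ he₂).trans ?_
    rw [numericalRange_eq_numRange, Matrix.map_neg _ Complex.ofReal_neg, map_neg, numRange_neg,
      ← numericalRange_eq_numRange]
    exact Set.neg_subset_neg.2 (numericalRange_sub_subset_decaySet hA hX hcare subset_rfl)
  calc singularValue (X.submatrix e₁ e₂) (h * (4 * ra + 2 * rq) + 1)
      ≤ singularValue (X.submatrix e₁ e₂)
          (2 * h * ((A.transpose - X).submatrix e₁ e₁ * X.submatrix e₁ e₂ -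
            X.submatrix e₁ e₂ * (-(A - X)).submatrix e₂ e₂).rank + 1) := by
        refine singularValue_antitone _ (Nat.add_le_add_right ?_ 1)
        calc _ ≤ 2 * h * (2 * ra + rq) :=
              Nat.mul_le_mul_left _ (hcare.rank_sylvester_submatrix_le he hA₁₂ hA₂₁ hQ₁₂)
          _ = h * (4 * ra + 2 * rq) := by ring
    _ ≤ 3 * (zolotarevNumber h (decaySet A Q) (-decaySet A Q)).toReal * ‖X.submatrix e₁ e₂‖ :=
        singularValue_le_zolotarevNumber _ hcompact hconvex hinf hcompact.neg hconvex.neg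
          (Set.infinite_neg.2 hinf) hL hN h
    _ ≤ 3 * (zolotarevNumber h (decaySet A Q) (-decaySet A Q)).toReal * ‖X‖ := by
        gcongr
        exact l2_opNorm_submatrix_le X he₁ he₂

theorem bijective_sumElim_subtype_val {α : Type*} {P R : α → Prop} (h : ∀ a, R a ↔ ¬P a) :
    Function.Bijective (Sum.elim (Subtype.val : {a // P a} → α) (Subtype.val : {a // R a} → α)) :=
  ⟨Subtype.val_injective.sumElim Subtype.val_injective fun a b hab => (h _).1 b.2 (hab ▸ a.2),
    fun a => (em (P a)).elim (fun ha => ⟨.inl ⟨a, ha⟩, rfl⟩) fun ha => ⟨.inr ⟨a, (h a).2 ha⟩, rfl⟩⟩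

theorem rank_lowerOffBlock_le_qsrank (B : Matrix (Fin n) (Fin n) ℝ) {s : ℕ}
    (hs : s ∈ Finset.Ico 1 n) : (lowerOffBlock B s).rank ≤ qsrank B :=
  (le_max_left _ _).trans (Finset.le_sup
    (f := fun s => max (lowerOffBlock B s).rank (upperOffBlock B s).rank) hs)

theorem rank_upperOffBlock_le_qsrank (B : Matrix (Fin n) (Fin n) ℝ) {s : ℕ}
    (hs : s ∈ Finset.Ico 1 n) : (upperOffBlock B s).rank ≤ qsrank B :=
  (le_max_right _ _).trans (Finset.le_sup
    (f := fun s => max (lowerOffBlock B s).rank (upperOffBlock B s).rank) hs)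

theorem three_le_one_add_sqrt_two_sq : (3 : ℝ) ≤ (1 + √2) ^ 2 := by
  nlinarith [Real.sq_sqrt (zero_le_two (α := ℝ)), Real.sqrt_nonneg 2]

theorem corollary2p4_general {s : ℕ} (hA : numericalRange A ⊆ {z : ℂ | z.re < 0})
    (hX : X.PosSemidef) (hcare : SolvesRiccati A 1 Q X) (h : ℕ) (hs : 1 ≤ s) (hsn : s < n) :
    singularValue (lowerOffBlock X s) (h * (4 * qsrank A + 2 * qsrank Q) + 1) ≤
        3 * (zolotarevNumber h (decaySet A Q) (-decaySet A Q)).toReal * ‖X‖ ∧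
      singularValue (upperOffBlock X s) (h * (4 * qsrank A + 2 * qsrank Q) + 1) ≤
        3 * (zolotarevNumber h (decaySet A Q) (-decaySet A Q)).toReal * ‖X‖ := by
  have : NeZero n := ⟨by omega⟩
  have hmem : s ∈ Finset.Ico 1 n := Finset.mem_Ico.2 ⟨hs, hsn⟩
  have hAl := rank_lowerOffBlock_le_qsrank A hmem
  have hAu := rank_upperOffBlock_le_qsrank A hmem
  exact ⟨hcare.singularValue_submatrix_le hA hX
      (bijective_sumElim_subtype_val fun _ => not_le.symm) hAl hAu
      (rank_lowerOffBlock_le_qsrank Q hmem) h,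
    hcare.singularValue_submatrix_le hA hX
      (bijective_sumElim_subtype_val fun _ => not_lt.symm) hAu hAl
      (rank_upperOffBlock_le_qsrank Q hmem) h⟩

end Blocks

end

theorem corollary2p4 (n : ℕ) (A Q X : Matrix (Fin n) (Fin n) ℝ) (ra rq : ℕ)
    (hra : qsrank A = ra) (hrq : qsrank Q = rq)
    (hA : numericalRange A ⊆ {z : ℂ | z.re < 0})
    (hQ : Q.PosSemidef) (hX : X.PosSemidef) (hcare : SolvesRiccati A 1 Q X)
    (h : ℕ) (hh : 1 ≤ h) (s : ℕ) (hs : 1 ≤ s) (hsn : s < n) :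
    singularValue (lowerOffBlock X s) (h * (4 * ra + 2 * rq) + 1) ≤
        (1 + Real.sqrt 2) ^ 2 *
          (zolotarevNumber h (decaySet A Q) (-decaySet A Q)).toReal * ‖X‖ ∧
      singularValue (upperOffBlock X s) (h * (4 * ra + 2 * rq) + 1) ≤
        (1 + Real.sqrt 2) ^ 2 *
          (zolotarevNumber h (decaySet A Q) (-decaySet A Q)).toReal * ‖X‖ := by
  subst hra hrq
  have hconst : 3 * (zolotarevNumber h (decaySet A Q) (-decaySet A Q)).toReal * ‖X‖ ≤
      (1 + Real.sqrt 2) ^ 2 * (zolotarevNumber h (decaySet A Q) (-decaySet A Q)).toReal * ‖X‖ := by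
    gcongr
    exact three_le_one_add_sqrt_two_sq
  exact (corollary2p4_general hA hX hcare h hs hsn).imp hconst.trans' hconst.trans'
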